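/- All graphs are finite and simple; $\mathrm{d}$ denotes graph distance and $\mathrm{diam}$ the diameter. A $3$-AP in a graph $G$ is a triple of vertices $(v_1,v_2,v_3)$ with $\mathrm{d}(v_1,v_2)=\mathrm{d}(v_2,v_3)$; it is rainbow under a vertex coloring if its three vertices have distinct colors. $\mathrm{aw}(G,3)$ is the least $r\ge 1$ such that every exact (i.e. surjective) $r$-coloring $V(G)\to\{1,\dots,r\}$ admits a rainbow $3$-AP. $G\square H$ is the Cartesian product. A graph $G$ is $3$-peripheral if it has three distinct vertices that are pairwise at distance $\mathrm{diam}(G)$. A vertex is peripheral if its eccentricity equals $\mathrm{diam}(G)$. For a tree $T$ and a peripheral vertex $v$, let $T_{v^-}$ be obtained from $T$ by removing all vertices at distance $\mathrm{diam}(T)$ from $v$; for any vertex $u$, let $T_{u^+}$ be obtained from $T$ by attaching one new leaf to $u$. A tree $T$ with at least two vertices is weakly non-$3$-peripheral if it is not $3$-peripheral and either $\mathrm{diam}(T)$ is odd and $T_{v^-}$ is $3$-peripheral for every peripheral vertex $v$, or $\mathrm{diam}(T)$ is even and $T_{u^+}$ is $3$-peripheral for some vertex $u$. **Corollary 1.4.**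 Let $T$ and $T'$ be trees, each with at least two vertices. Then $\mathrm{aw}(T\square T',3)=3$ if at least one of the following holds: 1. $T$ or $T'$ is $3$-peripheral; 2. $\mathrm{diam}(T\square T')$ is even and $T$ or $T'$ is isomorphic to the path $P_2$ on two vertices; 3. $\mathrm{diam}(T\square T')$ is even and $T$ or $T'$ is weakly non-$3$-peripheral. In all other cases $\mathrm{aw}(T\square T',3)=4$. -/

import Mathlib

namespace AntiVdW

/-- The list of vertices `v 0, …, v (k - 1)` is a `k`-term arithmetic progression in `G`: all
consecutive vertices are at one and the same (finite) distance `d`. -/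
def IsAP {V : Type*} (G : SimpleGraph V) {k : ℕ} (v : Fin k → V) : Prop :=
  ∃ d : ℕ, ∀ (i : ℕ) (hi : i + 1 < k),
    G.edist (v ⟨i, Nat.lt_of_succ_lt hi⟩) (v ⟨i + 1, hi⟩) = (d : ℕ∞)

/-- The coloring `c` of the vertices of `G` admits a rainbow `k`-term arithmetic progression. -/
def HasRainbowAP {V : Type*} (G : SimpleGraph V) (k : ℕ) {r : ℕ} (c : V → Fin r) : Prop :=
  ∃ v : Fin k → V, IsAP G v ∧ Function.Injective (c ∘ v)

/-- The anti-van der Waerden number: the least positive number `r` of colors such that every exact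
(that is, surjective) `r`-coloring of the vertices of `G` admits a rainbow `k`-term arithmetic
progression. For a finite graph such `r` exist, since there are no exact colorings with more
colors than vertices; `r = 0` is excluded because there `r`-colorings do not exist either. -/
noncomputable def aw {V : Type*} (G : SimpleGraph V) (k : ℕ) : ℕ :=
  sInf {r : ℕ | 0 < r ∧ ∀ c : V → Fin r, Function.Surjective c → HasRainbowAP G k c}

/-- A vertex is peripheral if its eccentricity is the diameter. -/
def IsPeripheralVertex {V : Type*} (G : SimpleGraph V) (v : V) : Prop :=
  G.eccent v = G.ediam

/-- `G` is `n`-peripheral: it has `n` distinct vertices that are pairwise at distance the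
diameter of `G`. -/
def IsPeripheral {V : Type*} (n : ℕ) (G : SimpleGraph V) : Prop :=
  ∃ u : Fin n → V, Function.Injective u ∧ ∀ i j, i ≠ j → G.dist (u i) (u j) = G.diam

/-- The graph `T_{v⁻}`: remove from `T` all vertices that realize the diameter of `T` with `v`. -/
def removeFar {V : Type*} (T : SimpleGraph V) (v : V) :
    SimpleGraph {x : V // T.dist v x ≠ T.diam} :=
  T.induce {x : V | T.dist v x ≠ T.diam}

/-- The graph `T_{u⁺}`: add to `T` one new vertex `none`, adjacent to `u` only. -/
def addLeaf {V : Type*} (T : SimpleGraph V) (u : V) : SimpleGraph (Option V) :=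
  T.map some ⊔ SimpleGraph.edge none (some u)

/-- Weakly non-3-peripheral (for nontrivial trees): `T` is non-3-peripheral and, if the diameter
is odd, `T_{v⁻}` is 3-peripheral for all peripheral vertices `v`; if the diameter is even,
`T_{v⁺}` is 3-peripheral for some vertex `v`. -/
def IsWeaklyNonThreePeripheral {V : Type*} (T : SimpleGraph V) : Prop :=
  ¬ IsPeripheral 3 T ∧
    ((Odd T.diam ∧ ∀ v, IsPeripheralVertex T v → IsPeripheral 3 (removeFar T v)) ∨
      (Even T.diam ∧ ∃ v, IsPeripheral 3 (addLeaf T v)))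

/-- The hypothesis on `T` and `T'` under which the anti-van der Waerden number of the Cartesian
product is three. -/
def ThreeCase {V W : Type*} (T : SimpleGraph V) (T' : SimpleGraph W) : Prop :=
  (IsPeripheral 3 T ∨ IsPeripheral 3 T') ∨
    (Even (T.boxProd T').diam ∧
      (Nonempty (T ≃g SimpleGraph.pathGraph 2) ∨ Nonempty (T' ≃g SimpleGraph.pathGraph 2))) ∨
    (Even (T.boxProd T').diam ∧
      (IsWeaklyNonThreePeripheral T ∨ IsWeaklyNonThreePeripheral T'))

end AntiVdW

/-!
Consider a coloring without rainbow 3-APs that uses at least three colors, and among all triples of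
distinct colors `c x`, `c m`, `c y` with `m` on a geodesic from `x` to `y` one for which
`d = dist x y` is least. Then `d` is odd, since otherwise a midpoint would give a rainbow 3-AP, and
all inner vertices of all geodesics from `x` to `y` have the color of `m`. In a product it follows
that every vertex at distance `d` from an end `x` has the color of `y` and is again an end, so that
one can keep walking in steps of length `d`. A fourth color then has no place, hence `aw ≤ 4`. If
one of the trees is 3-peripheral, such a walk leads to a vertex that has the color of `x` although
it lies between two ends. If one of them is weakly non-3-peripheral, the same happens unless `d` is
the diameter of the product, and `d` is the diameter as well if one of them is a single edge. As `d`
is odd, this is impossible if the diameter is even.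

In all other cases take spheres of odd radius around two far ends of the product, the radius being
the diameter or one less: products of trees are bipartite, so giving each sphere a color of its own
and all other vertices a third one leaves no rainbow 3-AP.
-/

namespace AntiVdW

open SimpleGraph

section Geodesics

variable {V : Type*} {G T : SimpleGraph V} {x y z : V}

lemma dist_add_dist_symm (h : G.dist x z + G.dist z y = G.dist x y) :
    G.dist y z + G.dist z x = G.dist y x := by
  rw [G.dist_comm (u := y), G.dist_comm (v := x), G.dist_comm (u := y), add_comm, h]

lemma exists_dist_eq_of_le (hG : G.Connected) {k : ℕ} (hk : k ≤ G.dist x y) :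
    ∃ z, G.dist x z = k ∧ G.dist x z + G.dist z y = G.dist x y := by
  obtain ⟨p, hp⟩ := hG.exists_walk_length_eq_dist x y
  have htake := dist_le (p.take k)
  have hdrop := dist_le (p.drop k)
  rw [Walk.take_length] at htake
  rw [Walk.drop_length] at hdrop
  have htri := hG.dist_triangle (u := x) (v := p.getVert k) (w := y)
  exact ⟨p.getVert k, by omega, by omega⟩

lemma exists_adj_dist_add_one (hG : G.Connected) (hxy : x ≠ y) :
    ∃ x', G.Adj x x' ∧ G.dist x' y + 1 = G.dist x y := by
  obtain ⟨x', hx', hadd⟩ := exists_dist_eq_of_le hG (hG.pos_dist_of_ne hxy)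
  exact ⟨x', dist_eq_one_iff_adj.1 hx', by omega⟩

lemma dist_add_one_eq_or_of_adj (hT : T.IsTree) {x' : V} (hadj : T.Adj x x') (z : V) :
    T.dist x' z + 1 = T.dist x z ∨ T.dist x' z = T.dist x z + 1 := by
  rw [T.dist_comm, T.dist_comm (u := x)]
  rcases hT.dist_eq_dist_add_one_of_adj z hadj with h | h <;> omega

lemma eq_of_adj_of_dist_add_one (hT : T.IsTree) {x₁ x₂ : V} (h₁ : T.Adj x x₁) (h₂ : T.Adj x x₂)
    (hd₁ : T.dist x₁ y + 1 = T.dist x y) (hd₂ : T.dist x₂ y + 1 = T.dist x y) : x₁ = x₂ := by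
  obtain ⟨p, hp⟩ := hT.1.exists_walk_length_eq_dist x₁ y
  obtain ⟨q, hq⟩ := hT.1.exists_walk_length_eq_dist x₂ y
  have hp' : (Walk.cons h₁ p).IsPath := Walk.isPath_of_length_eq_dist _ (by simp [hp, hd₁])
  have hq' : (Walk.cons h₂ q).IsPath := Walk.isPath_of_length_eq_dist _ (by simp [hq, hd₂])
  have hpath := (hT.2.subsingleton_path x y).elim ⟨_, hp'⟩ ⟨_, hq'⟩
  simpa using congrArg (fun w : T.Path x y ↦ w.1.snd) hpath

lemma dist_add_dist_of_adj (hT : T.IsTree) {x' : V} (hadj : T.Adj x x')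
    (hy : T.dist x' y + 1 = T.dist x y) (hz : T.dist x' z = T.dist x z + 1) :
    T.dist y x + T.dist x z = T.dist y z := by
  induction hn : T.dist x z generalizing x x' with
  | zero =>
    rw [hT.1.dist_eq_zero_iff] at hn
    rw [hn, add_zero]
  | succ n ih =>
    have hxz : x ≠ z := by
      rintro rfl
      simp at hn
    obtain ⟨x₂, hadj₂, hz₂⟩ := exists_adj_dist_add_one hT.1 hxz
    have hy₂ : T.dist x₂ y = T.dist x y + 1 := by
      refine (dist_add_one_eq_or_of_adj hT hadj₂ y).resolve_left fun h ↦ ?_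
      rw [eq_of_adj_of_dist_add_one hT hadj hadj₂ hy h] at hz
      omega
    have := ih hadj₂.symm hy₂.symm (by omega) (by omega)
    have := T.dist_comm (u := y) (v := x)
    have := T.dist_comm (u := y) (v := x₂)
    omega

lemma four_point (hT : T.IsTree) (x y z w : V) :
    T.dist x y + T.dist z w ≤ max (T.dist x z + T.dist y w) (T.dist x w + T.dist y z) := by
  induction hn : T.dist x y generalizing x with
  | zero =>
    rw [hT.1.dist_eq_zero_iff] at hn
    subst hn
    have := hT.1.dist_triangle (u := z) (v := x) (w := w)
    rw [T.dist_comm (u := z) (v := x)] at this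
    omega
  | succ n ih =>
    have hxy : x ≠ y := by
      rintro rfl
      simp at hn
    obtain ⟨x', hadj, hy⟩ := exists_adj_dist_add_one hT.1 hxy
    have IH := ih x' (by omega)
    have htri := hT.1.dist_triangle (u := z) (v := x) (w := w)
    have := T.dist_comm (u := z) (v := x)
    have := T.dist_comm (u := x) (v := y)
    have := T.dist_comm (u := z) (v := w)
    have := T.dist_comm (u := w) (v := x)
    rcases dist_add_one_eq_or_of_adj hT hadj z with hz | hz <;>
      rcases dist_add_one_eq_or_of_adj hT hadj w with hw | hw
    · omega
    · have := dist_add_dist_of_adj hT hadj hz hw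
      have := dist_add_dist_of_adj hT hadj hy hw
      omega
    · have := dist_add_dist_of_adj hT hadj hw hz
      have := dist_add_dist_of_adj hT hadj hy hz
      omega
    · have := dist_add_dist_of_adj hT hadj hy hz
      have := dist_add_dist_of_adj hT hadj hy hw
      omega

end Geodesics

section Modular

variable {V W : Type*} {G T : SimpleGraph V} {H : SimpleGraph W}

/-- Modular graphs: connected graphs in which any three vertices `x`, `y`, `z` have a median, a
vertex on geodesics between any two of them. Trees are modular, and, unlike trees, modular graphs
are closed under Cartesian products. -/
structure IsModular (G : SimpleGraph V) : Prop where
  connected : G.Connected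
  exists_median : ∀ x y z, ∃ m, G.dist x m + G.dist m y = G.dist x y ∧
    G.dist y m + G.dist m z = G.dist y z ∧ G.dist x m + G.dist m z = G.dist x z

lemma IsModular.even_perimeter (hG : IsModular G) (x y z : V) :
    Even (G.dist x y + G.dist y z + G.dist x z) := by
  obtain ⟨m, hxy, hyz, hxz⟩ := hG.exists_median x y z
  rw [G.dist_comm (u := m) (v := y)] at hxy
  exact ⟨G.dist x m + G.dist y m + G.dist m z, by omega⟩

lemma even_perimeter (hT : T.IsTree) (x y z : V) :
    Even (T.dist x y + T.dist y z + T.dist x z) := by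
  induction hn : T.dist x y generalizing x with
  | zero =>
    rw [hT.1.dist_eq_zero_iff] at hn
    subst hn
    exact ⟨T.dist x z, by omega⟩
  | succ n ih =>
    have hxy : x ≠ y := by
      rintro rfl
      simp at hn
    obtain ⟨x', hadj, hx'⟩ := exists_adj_dist_add_one hT.1 hxy
    have IH := ih x' (by omega)
    rw [Nat.even_iff] at IH ⊢
    rcases dist_add_one_eq_or_of_adj hT hadj z with hz | hz <;> omega

lemma isModular_of_isTree (hT : T.IsTree) : IsModular T where
  connected := hT.1
  exists_median x y z := by
    obtain ⟨k, hk⟩ := even_perimeter hT x y z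
    have := hT.1.dist_triangle (u := x) (v := y) (w := z)
    have := hT.1.dist_triangle (u := x) (v := z) (w := y)
    have := hT.1.dist_triangle (u := y) (v := x) (w := z)
    have := T.dist_comm (u := y) (v := x)
    have := T.dist_comm (u := z) (v := y)
    -- the distance of the median from `x` is the Gromov product of `y` and `z` at `x`
    obtain ⟨m, hm, hxy⟩ := exists_dist_eq_of_le hT.1 (x := x) (y := y) (k := k - T.dist y z)
      (by omega)
    have := four_point hT x y m z
    have := hT.1.dist_triangle (u := x) (v := m) (w := z)
    have := hT.1.dist_triangle (u := y) (v := m) (w := z)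
    have := T.dist_comm (u := m) (v := y)
    exact ⟨m, hxy, by omega, by omega⟩

lemma dist_boxProd (hG : G.Connected) (hH : H.Connected) (x y : V × W) :
    (G □ H).dist x y = G.dist x.1 y.1 + H.dist x.2 y.2 := by
  have h := edist_boxProd (G := G) (H := H) x y
  rw [← (hG.boxProd hH).preconnected x y |>.coe_dist_eq_edist,
    ← (hG.preconnected x.1 y.1).coe_dist_eq_edist,
    ← (hH.preconnected x.2 y.2).coe_dist_eq_edist] at h
  exact_mod_cast h

lemma dist_boxProd_swap (hG : G.Connected) (hH : H.Connected) (x y : V × W) :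
    (H □ G).dist x.swap y.swap = (G □ H).dist x y := by
  rw [dist_boxProd hG hH, dist_boxProd hH hG, Prod.fst_swap, Prod.snd_swap, Prod.fst_swap,
    Prod.snd_swap, add_comm]

lemma IsModular.boxProd (hG : IsModular G) (hH : IsModular H) : IsModular (G □ H) where
  connected := hG.connected.boxProd hH.connected
  exists_median x y z := by
    obtain ⟨a, haxy, hayz, haxz⟩ := hG.exists_median x.1 y.1 z.1
    obtain ⟨b, hbxy, hbyz, hbxz⟩ := hH.exists_median x.2 y.2 z.2
    refine ⟨(a, b), ?_, ?_, ?_⟩ <;> simp only [dist_boxProd hG.connected hH.connected] <;> omega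

end Modular


section Diameter

variable {V W : Type*} {G T : SimpleGraph V} {H : SimpleGraph W}

lemma ediam_ne_top_of_dist_le (hG : G.Connected) {n : ℕ} (h : ∀ x y, G.dist x y ≤ n) :
    G.ediam ≠ ⊤ := by
  refine ne_top_of_le_ne_top (ENat.natCast_ne_top n) (ediam_le_of_edist_le fun x y ↦ ?_)
  rw [← (hG x y).coe_dist_eq_edist]
  exact_mod_cast h x y

lemma diam_eq_of_dist_le (hG : G.Connected) {n : ℕ} (h : ∀ x y, G.dist x y ≤ n) {p q : V}
    (hpq : G.dist p q = n) : G.diam = n := by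
  have := hG.nonempty
  obtain ⟨x, y, hxy⟩ := G.exists_dist_eq_diam
  exact le_antisymm (hxy ▸ h x y) (hpq ▸ dist_le_diam (ediam_ne_top_of_dist_le hG h))

lemma diam_boxProd (hG : G.Connected) (hH : H.Connected) (hbG : G.ediam ≠ ⊤)
    (hbH : H.ediam ≠ ⊤) : (G □ H).diam = G.diam + H.diam := by
  have := hG.nonempty
  have := hH.nonempty
  obtain ⟨p, q, hpq⟩ := G.exists_dist_eq_diam
  obtain ⟨p', q', hpq'⟩ := H.exists_dist_eq_diam
  refine diam_eq_of_dist_le (hG.boxProd hH) (p := (p, p')) (q := (q, q')) (fun x y ↦ ?_) ?_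
  · rw [dist_boxProd hG hH]
    exact Nat.add_le_add (dist_le_diam hbG) (dist_le_diam hbH)
  · rw [dist_boxProd hG hH, hpq, hpq']

lemma dist_le_max_of_diametral (hT : T.IsTree) (hb : T.ediam ≠ ⊤) {p q : V}
    (hpq : T.dist p q = T.diam) (x z : V) : T.dist x z ≤ max (T.dist x p) (T.dist x q) := by
  have := four_point hT x z p q
  have := dist_le_diam hb (u := z) (v := p)
  have := dist_le_diam hb (u := z) (v := q)
  omega

lemma exists_dist_eq_diam_of_farthest (hT : T.IsTree) (hb : T.ediam ≠ ⊤) {x y : V}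
    (h : ∀ z, T.dist x z ≤ T.dist x y) : ∃ z, T.dist y z = T.diam := by
  have := hT.1.nonempty
  obtain ⟨p, q, hpq⟩ := T.exists_dist_eq_diam
  have := four_point hT x y p q
  have := h p
  have := h q
  rcases dist_le_diam hb (u := y) (v := p) |>.eq_or_lt with hp | hp
  · exact ⟨p, hp⟩
  · exact ⟨q, le_antisymm (dist_le_diam hb) (by omega)⟩

lemma isPeripheralVertex_iff (hG : G.Connected) (hb : G.ediam ≠ ⊤) {p : V} :
    IsPeripheralVertex G p ↔ ∃ q, G.dist p q = G.diam := by
  have := hG.nonempty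
  have hdiam : (G.diam : ℕ∞) = G.ediam := ENat.natCast_toNat hb
  constructor
  · intro h
    obtain ⟨q, hq⟩ := ENat.exists_eq_iSup_of_lt_top (f := G.edist p)
      (lt_top_iff_ne_top.2 (h.trans_ne hb))
    refine ⟨q, ?_⟩
    rw [SimpleGraph.dist, SimpleGraph.diam, ← h, hq, eccent_def]
  · rintro ⟨q, hq⟩
    refine le_antisymm eccent_le_ediam ?_
    rw [← hdiam, ← hq, (hG p q).coe_dist_eq_edist]
    exact edist_le_eccent

lemma isPeripheral_three_iff (hG : G.Connected) : IsPeripheral 3 G ↔ G.diam ≠ 0 ∧ ∃ p q r,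
    G.dist p q = G.diam ∧ G.dist p r = G.diam ∧ G.dist q r = G.diam := by
  constructor
  · rintro ⟨u, hu, h⟩
    refine ⟨?_, u 0, u 1, u 2, h 0 1 (by decide), h 0 2 (by decide), h 1 2 (by decide)⟩
    rw [← h 0 1 (by decide)]
    exact (hG.pos_dist_of_ne (hu.ne (by decide))).ne'
  · rintro ⟨h0, p, q, r, hpq, hpr, hqr⟩
    have h : ∀ i j, i ≠ j → G.dist (![p, q, r] i) (![p, q, r] j) = G.diam := by
      intro i j hij
      fin_cases i <;> fin_cases j <;> simp_all [G.dist_comm]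
    refine ⟨![p, q, r], fun i j hij ↦ ?_, h⟩
    by_contra hne
    refine h0 ?_
    rw [← h i j hne, hij, SimpleGraph.dist_self]

lemma nonempty_iso_pathGraph_two_iff [Nontrivial V] (hT : T.IsTree) :
    Nonempty (T ≃g pathGraph 2) ↔ T.diam = 1 := by
  rw [diam_eq_one, pathGraph_two_eq_top]
  constructor
  · rintro ⟨f⟩
    ext x y
    rw [← f.map_adj_iff, top_adj, top_adj, f.injective.ne_iff]
  · rintro rfl
    obtain ⟨x, y, hxy⟩ := exists_pair_ne V
    have hcard : Nat.card V = 2 := by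
      rw [Nat.card_eq_two_iff]
      refine ⟨x, y, hxy, Set.eq_univ_of_forall fun z ↦ ?_⟩
      by_contra! hz
      simp only [Set.mem_insert_iff, Set.mem_singleton_iff, not_or] at hz
      have := even_perimeter hT x y z
      rw [dist_top_of_ne hxy, dist_top_of_ne (Ne.symm hz.1), dist_top_of_ne (Ne.symm hz.2)] at this
      exact absurd this (by decide)
    have := Nat.finite_of_card_ne_zero (hcard ▸ two_ne_zero)
    exact ⟨Iso.completeGraph (Finite.equivFinOfCardEq hcard)⟩

end Diameter

section AddLeaf

variable {V : Type*} {G T : SimpleGraph V} {u : V}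

lemma le_add_dist_of_adj (hG : G.Connected) {φ : V → ℕ}
    (hφ : ∀ x y, G.Adj x y → φ x ≤ φ y + 1) (x y : V) : φ x ≤ φ y + G.dist x y := by
  obtain ⟨p, hp⟩ := hG.exists_walk_length_eq_dist x y
  rw [← hp]
  clear hp
  induction p with
  | nil => simp
  | cons h p ih =>
    have := hφ _ _ h
    rw [Walk.length_cons]
    omega

lemma addLeaf_adj_some {a b : V} : (addLeaf G u).Adj (some a) (some b) ↔ G.Adj a b := by
  simpa [addLeaf, edge_adj, map_adj'] using fun h ↦ h.ne

lemma addLeaf_adj_none {a : V} : (addLeaf G u).Adj none (some a) ↔ a = u := by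
  simp [addLeaf, map_adj', edge_adj]

/-- The inclusion of `G` into `G` with a leaf added. -/
def addLeafHom (G : SimpleGraph V) (u : V) : G →g addLeaf G u where
  toFun := some
  map_rel' h := addLeaf_adj_some.2 h

lemma connected_addLeaf (hG : G.Connected) (u : V) : (addLeaf G u).Connected := by
  rw [connected_iff_exists_forall_reachable]
  refine ⟨some u, fun x ↦ ?_⟩
  cases x with
  | none => exact (addLeaf_adj_none.2 rfl).symm.reachable
  | some a => exact (hG u a).map (addLeafHom G u)

lemma le_dist_addLeaf (hG : G.Connected) (u b : V) (x : Option V) :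
    x.elim (G.dist u b + 1) (G.dist · b) ≤ (addLeaf G u).dist x (some b) := by
  have h := le_add_dist_of_adj (connected_addLeaf hG u)
    (φ := fun x ↦ x.elim (G.dist u b + 1) (G.dist · b)) ?_ x (some b)
  · simpa using h
  intro x y hxy
  match x, y with
  | none, none => exact absurd hxy (addLeaf G u).irrefl
  | none, some a =>
    obtain rfl := addLeaf_adj_none.1 hxy
    rfl
  | some a, none =>
    obtain rfl := addLeaf_adj_none.1 hxy.symm
    simp only [Option.elim]
    omega
  | some a, some a' =>
    have := hG.dist_triangle (u := a) (v := a') (w := b)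
    have := dist_eq_one_iff_adj.2 (addLeaf_adj_some.1 hxy)
    simp only [Option.elim]
    omega

lemma dist_addLeaf_some_some (hG : G.Connected) (u a b : V) :
    (addLeaf G u).dist (some a) (some b) = G.dist a b := by
  refine le_antisymm ?_ (le_dist_addLeaf hG u b (some a))
  obtain ⟨p, hp⟩ := hG.exists_walk_length_eq_dist a b
  rw [← hp, ← Walk.length_map (addLeafHom G u) p]
  exact dist_le _

lemma dist_addLeaf_none_some (hG : G.Connected) (u b : V) :
    (addLeaf G u).dist none (some b) = G.dist u b + 1 := by
  refine le_antisymm ?_ (le_dist_addLeaf hG u b none)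
  have := (connected_addLeaf hG u).dist_triangle (u := none) (v := some u) (w := some b)
  rw [dist_addLeaf_some_some hG, dist_eq_one_iff_adj.2 (addLeaf_adj_none.2 rfl)] at this
  omega

lemma dist_addLeaf_le (hG : G.Connected) {n : ℕ} (hn : ∀ a b, G.dist a b ≤ n)
    (hu : ∀ a, G.dist u a < n) (x y : Option V) : (addLeaf G u).dist x y ≤ n := by
  match x, y with
  | none, none => simp
  | none, some a => exact dist_addLeaf_none_some hG u a ▸ hu a
  | some a, none => exact SimpleGraph.dist_comm ▸ dist_addLeaf_none_some hG u a ▸ hu a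
  | some a, some b => exact dist_addLeaf_some_some hG u a b ▸ hn a b

lemma diam_le_diam_addLeaf (hG : G.Connected) (hb : G.ediam ≠ ⊤) (u : V) :
    G.diam ≤ (addLeaf G u).diam := by
  have := hG.nonempty
  obtain ⟨a, b, hab⟩ := G.exists_dist_eq_diam
  rw [← hab, ← dist_addLeaf_some_some hG u]
  refine dist_le_diam (ediam_ne_top_of_dist_le (connected_addLeaf hG u)
    (dist_addLeaf_le hG (n := G.diam + 1) (fun a b ↦ ?_) fun a ↦ ?_))
  · exact (dist_le_diam hb).trans (Nat.le_succ _)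
  · exact Nat.lt_succ_of_le (dist_le_diam hb)

lemma exists_of_isPeripheral_addLeaf (hG : G.Connected) (hb : G.ediam ≠ ⊤)
    (hn : ¬ IsPeripheral 3 G) (h : IsPeripheral 3 (addLeaf G u)) :
    ∃ p q, G.dist p q = G.diam ∧ G.dist u p + 1 = G.diam ∧ G.dist u q + 1 = G.diam := by
  have hle := diam_le_diam_addLeaf hG hb u
  have hdist : ∀ p q, (addLeaf G u).dist none (some p) = (addLeaf G u).diam →
      (addLeaf G u).dist none (some q) = (addLeaf G u).diam →
      (addLeaf G u).dist (some p) (some q) = (addLeaf G u).diam →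
      G.dist p q = G.diam ∧ G.dist u p + 1 = G.diam ∧ G.dist u q + 1 = G.diam := by
    intro p q hp hq hpq
    rw [dist_addLeaf_none_some hG] at hp hq
    rw [dist_addLeaf_some_some hG] at hpq
    have := dist_le_diam hb (u := p) (v := q)
    omega
  obtain ⟨h0, x, y, z, hxy, hxz, hyz⟩ :=
    (isPeripheral_three_iff (connected_addLeaf hG u)).1 h
  match x, y, z with
  | some p, some q, some r =>
    rw [dist_addLeaf_some_some hG] at hxy hxz hyz
    have := dist_le_diam hb (u := p) (v := q)
    exact absurd ((isPeripheral_three_iff hG).2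
      ⟨by omega, p, q, r, by omega, by omega, by omega⟩) hn
  | none, some p, some q => exact ⟨p, q, hdist p q hxy hxz hyz⟩
  | some p, none, some q => exact ⟨p, q, hdist p q (SimpleGraph.dist_comm ▸ hxy) hyz hxz⟩
  | some p, some q, none =>
    exact ⟨p, q, hdist p q (SimpleGraph.dist_comm ▸ hxz) (SimpleGraph.dist_comm ▸ hyz) hxy⟩
  | none, none, _ => exact absurd (hxy.symm.trans SimpleGraph.dist_self) h0
  | none, some _, none => exact absurd (hxz.symm.trans SimpleGraph.dist_self) h0
  | some _, none, none => exact absurd (hyz.symm.trans SimpleGraph.dist_self) h0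

lemma isPeripheral_addLeaf_iff (hT : T.IsTree) (hb : T.ediam ≠ ⊤) (hn : ¬ IsPeripheral 3 T) :
    IsPeripheral 3 (addLeaf T u) ↔
      ∃ p q, T.dist p q = T.diam ∧ T.dist u p + 1 = T.diam ∧ T.dist u q + 1 = T.diam := by
  refine ⟨exists_of_isPeripheral_addLeaf hT.1 hb hn, ?_⟩
  rintro ⟨p, q, hpq, hp, hq⟩
  have hu (z : V) : T.dist u z < T.diam := by
    have := dist_le_max_of_diametral hT hb hpq u z
    omega
  have hdiam : (addLeaf T u).diam = T.diam :=
    diam_eq_of_dist_le (connected_addLeaf hT.1 u)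
      (dist_addLeaf_le hT.1 (fun _ _ ↦ dist_le_diam hb) hu) (p := some p) (q := some q)
      (by rw [dist_addLeaf_some_some hT.1, hpq])
  refine (isPeripheral_three_iff (connected_addLeaf hT.1 u)).2
    ⟨by omega, none, some p, some q, ?_, ?_, ?_⟩
  · rw [dist_addLeaf_none_some hT.1, hdiam, hp]
  · rw [dist_addLeaf_none_some hT.1, hdiam, hq]
  · rw [dist_addLeaf_some_some hT.1, hdiam, hpq]

end AddLeaf

section RemoveFar

variable {V : Type*} {G T : SimpleGraph V} {s : Set V} {u v : V}

/-- Geodesically convex sets of vertices: all geodesics between two vertices of `s` stay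
in `s`. -/
def IsGeodesicallyConvex (G : SimpleGraph V) (s : Set V) : Prop :=
  ∀ ⦃x⦄, x ∈ s → ∀ ⦃y⦄, y ∈ s → ∀ ⦃z⦄, G.dist x z + G.dist z y = G.dist x y → z ∈ s

lemma IsGeodesicallyConvex.exists_walk_induce (hG : G.Connected) (hs : IsGeodesicallyConvex G s)
    (x y : s) : ∃ p : (G.induce s).Walk x y, p.length = G.dist x y := by
  classical
  obtain ⟨p, hp⟩ := hG.exists_walk_length_eq_dist (x : V) y
  have hps : ∀ z ∈ p.support, z ∈ s := by
    intro z hz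
    have hlen := congrArg Walk.length (p.take_spec hz)
    rw [Walk.length_append] at hlen
    have := dist_le (p.takeUntil z hz)
    have := dist_le (p.dropUntil z hz)
    have := hG.dist_triangle (u := (x : V)) (v := z) (w := y)
    exact hs x.2 y.2 (by omega)
  refine ⟨p.induce s hps, ?_⟩
  rw [← hp, ← Walk.length_map (Embedding.induce s).toHom, Walk.map_induce]
  rfl

lemma IsGeodesicallyConvex.connected_induce (hG : G.Connected) (hs : IsGeodesicallyConvex G s)
    (hne : s.Nonempty) : (G.induce s).Connected := by
  have := hne.to_subtype
  exact ⟨fun x y ↦ (hs.exists_walk_induce hG x y).elim fun p _ ↦ ⟨p⟩⟩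

lemma IsGeodesicallyConvex.dist_induce (hG : G.Connected) (hs : IsGeodesicallyConvex G s)
    (x y : s) : (G.induce s).dist x y = G.dist x y := by
  obtain ⟨p, hp⟩ := hs.exists_walk_induce hG x y
  refine le_antisymm (hp ▸ dist_le p) ?_
  obtain ⟨q, hq⟩ := p.reachable.exists_walk_length_eq_dist
  rw [← hq, ← Walk.length_map (Embedding.induce s).toHom]
  exact dist_le _

lemma isGeodesicallyConvex_dist_ne_diam (hT : T.IsTree) (hb : T.ediam ≠ ⊤) (u : V) :
    IsGeodesicallyConvex T {x | T.dist u x ≠ T.diam} := by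
  intro x hx y hy z hz
  rw [Set.mem_ofPred_eq] at hx hy ⊢
  have := dist_le_diam hb (u := u) (v := x)
  have := dist_le_diam hb (u := u) (v := y)
  have := four_point hT u z x y
  have := T.dist_comm (u := z) (v := x)
  omega

lemma connected_removeFar [Nontrivial V] (hT : T.IsTree) (hb : T.ediam ≠ ⊤) (u : V) :
    (removeFar T u).Connected :=
  (isGeodesicallyConvex_dist_ne_diam hT hb u).connected_induce hT.1
    ⟨u, by rw [Set.mem_ofPred_eq, SimpleGraph.dist_self]
           exact (diam_ne_zero_of_ediam_ne_top hb).symm⟩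

lemma dist_removeFar (hT : T.IsTree) (hb : T.ediam ≠ ⊤)
    (x y : {x : V // T.dist u x ≠ T.diam}) : (removeFar T u).dist x y = T.dist x.1 y.1 :=
  (isGeodesicallyConvex_dist_ne_diam hT hb u).dist_induce hT.1 x y

lemma dist_lt_of_dist_ne_diam (hT : T.IsTree) (hb : T.ediam ≠ ⊤) (huv : T.dist u v = T.diam)
    {x y : V} (hx : T.dist u x ≠ T.diam) (hy : T.dist u y ≠ T.diam) : T.dist x y < T.diam := by
  have := four_point hT x y u v
  have := T.dist_comm (u := x) (v := u)
  have := T.dist_comm (u := y) (v := u)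
  have := dist_le_diam hb (u := u) (v := x)
  have := dist_le_diam hb (u := u) (v := y)
  have := dist_le_diam hb (u := x) (v := v)
  have := dist_le_diam hb (u := y) (v := v)
  omega

lemma diam_removeFar [Nontrivial V] (hT : T.IsTree) (hb : T.ediam ≠ ⊤)
    (huv : T.dist u v = T.diam) : (removeFar T u).diam + 1 = T.diam := by
  have h0 := diam_ne_zero_of_ediam_ne_top hb
  obtain ⟨w, hw, -⟩ := exists_dist_eq_of_le hT.1 (huv ▸ T.diam.sub_le 1)
  have : (removeFar T u).diam = T.diam - 1 :=
    diam_eq_of_dist_le (connected_removeFar hT hb u) (p := ⟨u, by simpa using h0.symm⟩)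
      (q := ⟨w, by omega⟩) (fun x y ↦ by
        have := dist_lt_of_dist_ne_diam hT hb huv x.2 y.2
        rw [dist_removeFar hT hb]
        omega)
      (by rw [dist_removeFar hT hb, hw, huv])
  omega

lemma exists_of_isPeripheral_removeFar [Nontrivial V] (hT : T.IsTree) (hb : T.ediam ≠ ⊤)
    (huv : T.dist u v = T.diam) (h : IsPeripheral 3 (removeFar T u)) :
    2 ≤ T.diam ∧ ∃ t, T.dist u t + 1 = T.diam ∧ T.dist v t = T.diam := by
  obtain ⟨h0, x, y, z, hxy, hxz, hyz⟩ :=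
    (isPeripheral_three_iff (connected_removeFar hT hb u)).1 h
  have hd := diam_removeFar hT hb huv
  rw [dist_removeFar hT hb] at hxy hxz hyz
  refine ⟨by omega, ?_⟩
  by_contra! hcon
  have hlt (s : {x : V // T.dist u x ≠ T.diam}) : T.dist u s.1 < T.diam :=
    (dist_le_diam hb).lt_of_ne s.2
  have := hlt x
  have := hlt y
  have := hlt z
  have := hcon x.1
  have := hcon y.1
  have := hcon z.1
  have := dist_le_diam hb (u := v) (v := x.1)
  have := dist_le_diam hb (u := v) (v := y.1)
  have := dist_le_diam hb (u := v) (v := z.1)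
  have := four_point hT u v x.1 y.1
  have := four_point hT u v x.1 z.1
  have := four_point hT u v y.1 z.1
  omega

lemma isPeripheral_removeFar_iff [Nontrivial V] (hT : T.IsTree) (hb : T.ediam ≠ ⊤)
    (huv : T.dist u v = T.diam) : IsPeripheral 3 (removeFar T u) ↔
      2 ≤ T.diam ∧ ∃ t, T.dist u t + 1 = T.diam ∧ T.dist v t = T.diam := by
  refine ⟨exists_of_isPeripheral_removeFar hT hb huv, ?_⟩
  rintro ⟨h2, t, hut, hvt⟩
  have hd := diam_removeFar hT hb huv
  obtain ⟨w, hw, hw'⟩ := exists_dist_eq_of_le hT.1 (huv ▸ T.diam.sub_le 1)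
  have hu : T.dist u u ≠ T.diam := by
    rw [SimpleGraph.dist_self]
    omega
  have ht : T.dist u t ≠ T.diam := by omega
  have hw'' : T.dist u w ≠ T.diam := by omega
  have := dist_lt_of_dist_ne_diam hT hb huv ht hw''
  have := hT.1.dist_triangle (u := t) (v := w) (w := v)
  have := T.dist_comm (u := v) (v := t)
  refine (isPeripheral_three_iff (connected_removeFar hT hb u)).2
    ⟨by omega, ⟨u, hu⟩, ⟨t, ht⟩, ⟨w, hw''⟩, ?_, ?_, ?_⟩ <;> rw [dist_removeFar hT hb] <;>
    dsimp only <;> omega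

end RemoveFar

section Rainbow

variable {V C : Type*} {G : SimpleGraph V} {c : V → C}

/-- The coloring `c` of the vertices of `G` has no rainbow 3-AP. Here `C` is arbitrary, so that `c`
need not be exact. -/
def RainbowFree (G : SimpleGraph V) (c : V → C) : Prop :=
  ∀ x y z, G.dist x y = G.dist y z → c x ≠ c y → c y ≠ c z → c x = c z

/-- A rainbow geodesic: `m` lies on a geodesic from `x` to `y`, and `x`, `m`, `y` have three
distinct colors. -/
structure RainbowBetween (G : SimpleGraph V) (c : V → C) (x m y : V) : Prop where
  dist_add_dist : G.dist x m + G.dist m y = G.dist x y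
  left_ne : c x ≠ c m
  right_ne : c m ≠ c y
  ends_ne : c x ≠ c y

/-- A rainbow geodesic that is shortest among all rainbow geodesics of the coloring. -/
structure ShortestRainbow (G : SimpleGraph V) (c : V → C) (x m y : V) : Prop
    extends RainbowBetween G c x m y where
  dist_le : ∀ {x' m' y'}, RainbowBetween G c x' m' y' → G.dist x y ≤ G.dist x' y'

variable {x m y z : V}

lemma RainbowFree.color_eq {p q : V} (hc : RainbowFree G c) (hp : G.dist y p = G.dist p z)
    (hq : G.dist y q = G.dist q z) (hyp : c y ≠ c p) (hyq : c y ≠ c q) (hpq : c p ≠ c q) :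
    c z = c y := by
  by_contra hzy
  have hzp : c p = c z := not_not.1 fun h ↦ hzy (hc y p z hp hyp h).symm
  have hzq : c q = c z := not_not.1 fun h ↦ hzy (hc y q z hq hyq h).symm
  exact hpq (hzp.trans hzq.symm)

lemma RainbowBetween.symm (h : RainbowBetween G c x m y) : RainbowBetween G c y m x where
  dist_add_dist := dist_add_dist_symm h.dist_add_dist
  left_ne := h.right_ne.symm
  right_ne := h.left_ne.symm
  ends_ne := h.ends_ne.symm

namespace ShortestRainbow

lemma symm (h : ShortestRainbow G c x m y) : ShortestRainbow G c y m x where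
  toRainbowBetween := h.toRainbowBetween.symm
  dist_le h' := by
    rw [G.dist_comm]
    exact h.dist_le h'

lemma color_eq_of_between_left (hG : G.Connected) (h : ShortestRainbow G c x m y)
    (hz : G.dist x z + G.dist z m = G.dist x m) (hzx : z ≠ x) : c z = c m := by
  by_contra hzm
  have := h.dist_add_dist
  have := hG.dist_triangle (u := x) (v := z) (w := y)
  have := hG.dist_triangle (u := z) (v := m) (w := y)
  have := hG.pos_dist_of_ne hzx.symm
  have := hG.pos_dist_of_ne (ne_of_apply_ne c h.right_ne)
  have hzy : c z = c y := by
    by_contra hzy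
    have := h.dist_le ⟨by omega, hzm, h.right_ne, hzy⟩
    omega
  have := h.dist_le ⟨hz, hzy ▸ h.ends_ne, hzm, h.left_ne⟩
  omega

lemma color_eq_of_between_right (hG : G.Connected) (h : ShortestRainbow G c x m y)
    (hz : G.dist m z + G.dist z y = G.dist m y) (hzy : z ≠ y) : c z = c m :=
  h.symm.color_eq_of_between_left hG (dist_add_dist_symm hz) hzy

lemma odd_dist (hG : G.Connected) (hc : RainbowFree G c) (h : ShortestRainbow G c x m y) :
    Odd (G.dist x y) := by
  by_contra heven
  obtain ⟨e, he⟩ := Nat.not_odd_iff_even.1 heven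
  have := h.dist_add_dist
  have := hG.pos_dist_of_ne (ne_of_apply_ne c h.ends_ne)
  -- the midpoint of the geodesic through `m` has the color of `m`
  obtain ⟨k, hxk, hky, hkm⟩ : ∃ k, G.dist x k = e ∧ G.dist k y = e ∧ c k = c m := by
    rcases le_total e (G.dist x m) with hle | hle
    · obtain ⟨k, hk, hkm⟩ := exists_dist_eq_of_le hG hle
      have := hG.dist_triangle (u := k) (v := m) (w := y)
      have := hG.dist_triangle (u := x) (v := k) (w := y)
      refine ⟨k, hk, by omega, h.color_eq_of_between_left hG hkm ?_⟩
      rintro rfl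
      rw [SimpleGraph.dist_self] at hk
      omega
    · obtain ⟨k, hk, hkm⟩ := exists_dist_eq_of_le hG (x := m) (y := y) (k := e - G.dist x m)
        (by omega)
      have := hG.dist_triangle (u := x) (v := m) (w := k)
      have := hG.dist_triangle (u := x) (v := k) (w := y)
      refine ⟨k, by omega, by omega, h.color_eq_of_between_right hG hkm ?_⟩
      rintro rfl
      rw [SimpleGraph.dist_self] at hkm
      omega
  exact h.ends_ne (hc x k y (hxk.trans hky.symm) (hkm ▸ h.left_ne) (hkm ▸ h.right_ne))

lemma of_color_ne (hG : IsModular G) (h : ShortestRainbow G c x m y)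
    (hz : G.dist x z + G.dist z y = G.dist x y) (hzx : z ≠ x) (hzm : c z ≠ c m)
    (hzy : c z ≠ c y) : ShortestRainbow G c z y m := by
  have hxmy := h.dist_add_dist
  have hxz := hG.connected.pos_dist_of_ne hzx.symm
  have hxm := hG.connected.pos_dist_of_ne (ne_of_apply_ne c h.left_ne)
  obtain ⟨n, hznm, hmny, hzny⟩ := hG.exists_median z m y
  have hcn : c n = c y := by
    by_contra hny
    have hnz : c n = c z := by
      by_contra hnz
      have := h.dist_le ⟨hzny, Ne.symm hnz, hny, hzy⟩
      omega
    have := h.dist_le ⟨hmny, by rw [hnz]; exact hzm.symm, hny, h.right_ne⟩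
    omega
  have hny : n = y := by
    by_contra hny
    have := hG.connected.pos_dist_of_ne hny
    have := hG.connected.dist_triangle (u := x) (v := m) (w := n)
    have := hG.connected.dist_triangle (u := x) (v := n) (w := y)
    have := h.dist_le (x' := x) (m' := m) (y' := n)
      ⟨by omega, h.left_ne, hcn ▸ h.right_ne, hcn ▸ h.ends_ne⟩
    omega
  subst hny
  have hle := hG.connected.dist_triangle (u := z) (v := x) (w := m)
  have := G.dist_comm (u := z) (v := x)
  have := G.dist_comm (u := n) (v := m)
  refine ⟨⟨hznm, hzy, h.right_ne.symm, hzm⟩, fun h' ↦ le_trans ?_ (h.dist_le h')⟩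
  omega

lemma color_eq_of_color_ne (hG : IsModular G) (hc : RainbowFree G c)
    (h : ShortestRainbow G c x m y) (hz : G.dist x z + G.dist z y = G.dist x y) (hzx : z ≠ x)
    (hzy : c z ≠ c y) : c z = c m := by
  by_contra hzm
  have h' := h.of_color_ne hG hz hzx hzm hzy
  have hd := le_antisymm (h.dist_le h'.toRainbowBetween) (h'.dist_le h.toRainbowBetween)
  have hxmy := h.dist_add_dist
  have hzym := h'.dist_add_dist
  have := G.dist_comm (u := y) (v := m)
  have := hG.connected.pos_dist_of_ne (ne_of_apply_ne c h.left_ne)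
  have := hG.connected.pos_dist_of_ne (ne_of_apply_ne c h.right_ne)
  rcases (by omega : 2 ≤ G.dist m y ∨ G.dist m y = 1) with hmy | hmy
  -- an inner vertex of a geodesic from `m` to `y` would have the colors of both `m` and `y`
  · obtain ⟨k, hk, hmky⟩ := exists_dist_eq_of_le hG.connected (x := m) (y := y) (k := 1) (by omega)
    have hkm : c k = c m := h.color_eq_of_between_right hG.connected hmky
      (by rintro rfl; omega)
    have hky : c k = c y := h'.color_eq_of_between_right hG.connected (dist_add_dist_symm hmky)
      (by rintro rfl; rw [SimpleGraph.dist_self] at hk; omega)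
    exact h.right_ne (hkm.symm.trans hky)
  -- the neighbor `l` of `y` on a geodesic to `z` has the color of `y`, and `l`, `x`, `m` is a 3-AP
  · obtain ⟨j, hj⟩ := h.odd_dist hG.connected hc
    obtain ⟨l, hl, hzly⟩ := exists_dist_eq_of_le hG.connected (Nat.sub_le (G.dist z y) 1)
    have hly : c l = c y := h'.color_eq_of_between_left hG.connected hzly
      (by rintro rfl; rw [SimpleGraph.dist_self] at hl; omega)
    have := hG.connected.dist_triangle (u := x) (v := z) (w := l)
    have := hG.connected.dist_triangle (u := x) (v := l) (w := y)
    have := G.dist_comm (u := l) (v := x)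
    exact h.right_ne (hly ▸ (hc l x m (by omega) (hly ▸ h.ends_ne.symm) h.left_ne).symm)

lemma color_eq_of_between (hG : IsModular G) (hc : RainbowFree G c)
    (h : ShortestRainbow G c x m y) (hz : G.dist x z + G.dist z y = G.dist x y) (hzx : z ≠ x)
    (hzy : z ≠ y) : c z = c m := by
  by_cases hcol : c z = c y
  · exact h.symm.color_eq_of_color_ne hG hc (dist_add_dist_symm hz) hzy (hcol ▸ h.ends_ne.symm)
  · exact h.color_eq_of_color_ne hG hc hz hzx hcol

end ShortestRainbow

lemma exists_shortestRainbow (hG : IsModular G) (hxy : c x ≠ c y) (hyz : c y ≠ c z)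
    (hxz : c x ≠ c z) : ∃ x' m' y', ShortestRainbow G c x' m' y' := by
  classical
  have hex : ∃ d x' m' y', G.dist x' y' = d ∧ RainbowBetween G c x' m' y' := by
    obtain ⟨m, hxmy, hymz, hxmz⟩ := hG.exists_median x y z
    by_cases hx : c x = c m
    · exact ⟨_, y, m, z, rfl, hymz, hx ▸ hxy.symm, hx ▸ hxz, hyz⟩
    by_cases hy : c y = c m
    · exact ⟨_, x, m, z, rfl, hxmz, hx, hy ▸ hyz, hxz⟩
    · exact ⟨_, x, m, y, rfl, hxmy, hx, Ne.symm hy, hxy⟩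
  obtain ⟨x', m', y', hd, h⟩ := Nat.find_spec hex
  exact ⟨x', m', y', h, fun h' ↦ hd ▸ Nat.find_min' hex ⟨_, _, _, rfl, h'⟩⟩

/-- The vertices `x` and `y` are the ends of a shortest rainbow geodesic of length `d` whose inner
vertex has the color `w`. -/
def RainbowEnds (G : SimpleGraph V) (c : V → C) (d : ℕ) (w : C) (x y : V) : Prop :=
  ∃ m, ShortestRainbow G c x m y ∧ G.dist x y = d ∧ c m = w

namespace RainbowEnds

variable {d : ℕ} {w : C} {e : V}

lemma symm (h : RainbowEnds G c d w x y) : RainbowEnds G c d w y x := by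
  obtain ⟨m, hm, hd, hw⟩ := h
  exact ⟨m, hm.symm, by rw [G.dist_comm, hd], hw⟩

lemma dist_eq (h : RainbowEnds G c d w x y) : G.dist x y = d :=
  h.elim fun _ hm ↦ hm.2.1

lemma left_ne (h : RainbowEnds G c d w x y) : c x ≠ w := by
  obtain ⟨m, hm, -, rfl⟩ := h
  exact hm.left_ne

lemma ends_ne (h : RainbowEnds G c d w x y) : c x ≠ c y :=
  h.elim fun _ hm ↦ hm.1.ends_ne

lemma le_dist {x' m' y' : V} (h : RainbowEnds G c d w x y) (h' : RainbowBetween G c x' m' y') :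
    d ≤ G.dist x' y' := by
  obtain ⟨m, hm, rfl, -⟩ := h
  exact hm.dist_le h'

lemma odd (hG : G.Connected) (hc : RainbowFree G c) (h : RainbowEnds G c d w x y) : Odd d := by
  obtain ⟨m, hm, rfl, -⟩ := h
  exact hm.odd_dist hG hc

lemma three_le (hG : G.Connected) (hc : RainbowFree G c) (h : RainbowEnds G c d w x y) : 3 ≤ d := by
  obtain ⟨j, hj⟩ := h.odd hG hc
  obtain ⟨m, hm, hd, -⟩ := h
  have := hm.dist_add_dist
  have := hG.pos_dist_of_ne (ne_of_apply_ne c hm.left_ne)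
  have := hG.pos_dist_of_ne (ne_of_apply_ne c hm.right_ne)
  omega

lemma color_eq (hG : IsModular G) (hc : RainbowFree G c) (h : RainbowEnds G c d w x y)
    (hz : G.dist x z + G.dist z y = d) (hxz : G.dist x z ≠ 0) (hzy : G.dist z y ≠ 0) :
    c z = w := by
  obtain ⟨m, hm, rfl, rfl⟩ := h
  exact hm.color_eq_of_between hG hc hz (by rintro rfl; exact hxz SimpleGraph.dist_self)
    (by rintro rfl; exact hzy SimpleGraph.dist_self)

lemma of_common (hG : IsModular G) (hc : RainbowFree G c) (h : RainbowEnds G c d w x y)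
    (hz : G.dist x z = d) (hey : G.dist x e + G.dist e y = d) (hez : G.dist x e + G.dist e z = d)
    (he : G.dist x e ≠ 0) : RainbowEnds G c d w x z ∧ c z = c y := by
  obtain ⟨n, hxny, hynz, hxnz⟩ := hG.exists_median x y z
  have := hG.connected.dist_triangle (u := y) (v := e) (w := z)
  have := G.dist_comm (u := y) (v := e)
  have := G.dist_comm (u := y) (v := n)
  have := G.dist_comm (u := y) (v := x)
  have := h.dist_eq
  by_cases hny : G.dist n y = 0
  · have hnz : G.dist n z = 0 := by omega
    rw [hG.connected.dist_eq_zero_iff] at hny hnz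
    obtain rfl : y = z := hny.symm.trans hnz
    exact ⟨h, rfl⟩
  have hn : c n = w := h.color_eq hG hc (by omega) (by omega) hny
  have hzy : c z = c y := by
    refine hc.color_eq (p := x) (q := n) (by omega) (by omega) h.ends_ne.symm ?_ ?_ <;> rw [hn]
    exacts [h.symm.left_ne, h.left_ne]
  refine ⟨⟨n, ⟨⟨hxnz, ?_, ?_, ?_⟩, fun h' ↦ hz ▸ h.le_dist h'⟩, hz, hn⟩, hzy⟩
  · exact hn ▸ h.left_ne
  · exact hn ▸ hzy ▸ h.symm.left_ne.symm
  · exact hzy ▸ h.ends_ne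

end RainbowEnds

end Rainbow

section Product

variable {V W C : Type*} {G : SimpleGraph V} {H : SimpleGraph W} {c : V × W → C} {d : ℕ} {w : C}

lemma RainbowFree.swap (hG : G.Connected) (hH : H.Connected) (hc : RainbowFree (G □ H) c) :
    RainbowFree (H □ G) (c ∘ Prod.swap) := fun x y z h ↦
  hc x.swap y.swap z.swap (by rwa [dist_boxProd_swap hH hG, dist_boxProd_swap hH hG])

lemma RainbowBetween.swap (hG : G.Connected) (hH : H.Connected) {x m y : V × W}
    (h : RainbowBetween (G □ H) c x m y) :
    RainbowBetween (H □ G) (c ∘ Prod.swap) x.swap m.swap y.swap where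
  dist_add_dist := by simpa only [dist_boxProd_swap hG hH] using h.dist_add_dist
  left_ne := h.left_ne
  right_ne := h.right_ne
  ends_ne := h.ends_ne

namespace RainbowEnds

lemma swap (hG : G.Connected) (hH : H.Connected) {x y : V × W}
    (h : RainbowEnds (G □ H) c d w x y) :
    RainbowEnds (H □ G) (c ∘ Prod.swap) d w x.swap y.swap := by
  obtain ⟨m, hm, rfl, hw⟩ := h
  have hd := dist_boxProd_swap hG hH x y
  refine ⟨m.swap, ⟨hm.toRainbowBetween.swap hG hH, fun h' ↦ ?_⟩, hd, hw⟩
  rw [hd, ← dist_boxProd_swap hH hG]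
  exact hm.dist_le (h'.swap hH hG)

variable {x y : V × W}

lemma dist_add_dist_eq (hG : G.Connected) (hH : H.Connected)
    (h : RainbowEnds (G □ H) c d w x y) : G.dist x.1 y.1 + H.dist x.2 y.2 = d :=
  (dist_boxProd hG hH x y).symm.trans h.dist_eq

lemma snd_ne [Nontrivial W] (hG : IsModular G) (hH : IsModular H) (hc : RainbowFree (G □ H) c)
    (h : RainbowEnds (G □ H) c d w x y) : x.2 ≠ y.2 := by
  have hGH := hG.boxProd hH
  have hdist := dist_boxProd hG.connected hH.connected
  have hd3 := h.three_le hGH.connected hc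
  have hd := h.dist_add_dist_eq hG.connected hH.connected
  obtain ⟨a, b⟩ := x
  obtain ⟨a', b'⟩ := y
  rintro (rfl : b = b')
  dsimp only at hd
  rw [SimpleGraph.dist_self, add_zero] at hd
  obtain ⟨b₁, hb₁⟩ := hH.connected.preconnected.exists_adj_of_nontrivial b
  rw [← dist_eq_one_iff_adj] at hb₁
  obtain ⟨a₁, ha₁, ha₁'⟩ := exists_dist_eq_of_le hG.connected (x := a) (y := a') (k := 1) (by omega)
  obtain ⟨a₂, ha₂, ha₂'⟩ := exists_dist_eq_of_le hG.connected (x := a₁) (y := a') (k := d - 2)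
    (by omega)
  have := hG.connected.dist_triangle (u := a) (v := a₁) (w := a₂)
  have := hG.connected.dist_triangle (u := a) (v := a₂) (w := a')
  have := H.dist_comm (u := b₁) (v := b)
  have := G.dist_comm (u := a₂) (v := a')
  have := G.dist_comm (u := a₁) (v := a')
  have := G.dist_comm (u := a₁) (v := a)
  have := G.dist_comm (u := a) (v := a')
  -- `(a₁, b₁)` and `(a', b)` are again ends, and `(a₂, b₁)` has the color of `(a', b)`,
  -- although it is between them
  obtain ⟨h₁, -⟩ := h.symm.of_common hGH hc (z := (a₁, b₁)) (e := (a₁, b))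
    (by simp only [hdist]; omega) (by simp only [hdist, SimpleGraph.dist_self]; omega)
    (by simp only [hdist, SimpleGraph.dist_self]; omega) (by simp only [hdist]; omega)
  obtain ⟨-, h₂⟩ := h.of_common hGH hc (z := (a₂, b₁)) (e := (a₂, b))
    (by simp only [hdist]; omega) (by simp only [hdist, SimpleGraph.dist_self]; omega)
    (by simp only [hdist, SimpleGraph.dist_self]; omega) (by simp only [hdist]; omega)
  have := h₁.symm.color_eq hGH hc (z := (a₂, b₁))
    (by simp only [hdist, SimpleGraph.dist_self]; omega) (by simp only [hdist]; omega)
    (by simp only [hdist]; omega)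
  exact h.symm.left_ne (h₂.symm.trans this)

lemma fst_ne [Nontrivial V] (hG : IsModular G) (hH : IsModular H) (hc : RainbowFree (G □ H) c)
    (h : RainbowEnds (G □ H) c d w x y) : x.1 ≠ y.1 :=
  (h.swap hG.connected hH.connected).snd_ne hH hG (hc.swap hG.connected hH.connected)

lemma sphere_of_le [Nontrivial V] [Nontrivial W] (hG : IsModular G) (hH : IsModular H)
    (hc : RainbowFree (G □ H) c) (h : RainbowEnds (G □ H) c d w x y) {a : V} {b : W}
    (hab : G.dist x.1 a + H.dist x.2 b = d) (hle : H.dist x.2 y.2 ≤ H.dist x.2 b) :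
    RainbowEnds (G □ H) c d w x (a, b) ∧ c (a, b) = c y := by
  have hGH := hG.boxProd hH
  have hdist := dist_boxProd hG.connected hH.connected
  have hd := h.dist_add_dist_eq hG.connected hH.connected
  have := hG.connected.pos_dist_of_ne (h.fst_ne hG hH hc)
  have := hH.connected.pos_dist_of_ne (h.snd_ne hG hH hc)
  obtain ⟨b', hb', hb'b⟩ := exists_dist_eq_of_le hH.connected hle
  obtain ⟨h', hcol⟩ := h.of_common hGH hc (z := (y.1, b')) (e := (y.1, x.2))
    (by simp only [hdist]; omega) (by simp only [hdist, SimpleGraph.dist_self]; omega)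
    (by simp only [hdist, SimpleGraph.dist_self]; omega) (by simp only [hdist]; omega)
  rw [← hcol]
  exact h'.of_common hGH hc (e := (x.1, b')) (by simp only [hdist]; omega)
    (by simp only [hdist, SimpleGraph.dist_self]; omega)
    (by simp only [hdist, SimpleGraph.dist_self]; omega) (by simp only [hdist]; omega)

/- The sphere of radius `d` around `x` is swept out by steps between two of its vertices that share
an inner vertex of geodesics from `x`. -/
lemma sphere [Nontrivial V] [Nontrivial W] (hG : IsModular G) (hH : IsModular H)
    (hc : RainbowFree (G □ H) c) (h : RainbowEnds (G □ H) c d w x y) {a : V} {b : W}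
    (hab : G.dist x.1 a + H.dist x.2 b = d) :
    RainbowEnds (G □ H) c d w x (a, b) ∧ c (a, b) = c y := by
  rcases le_total (H.dist x.2 y.2) (H.dist x.2 b) with hle | hle
  · exact h.sphere_of_le hG hH hc hab hle
  · have hd := h.dist_add_dist_eq hG.connected hH.connected
    obtain ⟨h', hcol⟩ := (h.swap hG.connected hH.connected).sphere_of_le hH hG
      (hc.swap hG.connected hH.connected) (a := b) (b := a)
      (by simp only [Prod.fst_swap, Prod.snd_swap]; omega)
      (by simp only [Prod.snd_swap]; omega)
    exact ⟨h'.swap hH.connected hG.connected, hcol⟩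

lemma dist_fst_lt [Nontrivial V] [Nontrivial W] (hG : IsModular G) (hH : IsModular H)
    (hc : RainbowFree (G □ H) c) (h : RainbowEnds (G □ H) c d w x y) (a : V) :
    G.dist x.1 a < d := by
  by_contra! hle
  obtain ⟨a', ha', -⟩ := exists_dist_eq_of_le hG.connected hle
  exact (h.sphere hG hH hc (a := a') (b := x.2) (by simp [ha'])).1.snd_ne hG hH hc rfl

lemma dist_snd_lt [Nontrivial V] [Nontrivial W] (hG : IsModular G) (hH : IsModular H)
    (hc : RainbowFree (G □ H) c) (h : RainbowEnds (G □ H) c d w x y) (b : W) :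
    H.dist x.2 b < d :=
  (h.swap hG.connected hH.connected).dist_fst_lt hH hG (hc.swap hG.connected hH.connected) b

lemma dist_lt_of_color_ne [Nontrivial V] [Nontrivial W] (hG : IsModular G) (hH : IsModular H)
    (hc : RainbowFree (G □ H) c) (h : RainbowEnds (G □ H) c d w x y) {g : V × W}
    (hgy : c g ≠ c y) (hgw : c g ≠ w) : (G □ H).dist x g < d := by
  by_contra! hle
  obtain ⟨g₁, g₂⟩ := g
  have hdist := dist_boxProd hG.connected hH.connected
  have := h.dist_fst_lt hG hH hc g₁
  have := h.dist_snd_lt hG hH hc g₂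
  simp only [hdist] at hle
  -- `(g₁, t)` has the color of `y` and `(g₁, t₁)`, one step closer to `x`, has the color `w`
  obtain ⟨t, ht, htg⟩ := exists_dist_eq_of_le hH.connected (x := x.2) (y := g₂)
    (k := d - G.dist x.1 g₁) (by omega)
  obtain ⟨t₁, ht₁, htt₁⟩ := exists_dist_eq_of_le hH.connected (Nat.sub_le (H.dist x.2 t) 1)
  obtain ⟨h', hcol⟩ := h.sphere hG hH hc (a := g₁) (b := t) (by omega)
  have := hH.connected.dist_triangle (u := x.2) (v := t₁) (w := g₂)
  have := hH.connected.dist_triangle (u := t₁) (v := t) (w := g₂)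
  have hw := h'.color_eq (hG.boxProd hH) hc (z := (g₁, t₁))
    (by simp only [hdist, SimpleGraph.dist_self]; omega) (by simp only [hdist]; omega)
    (by simp only [hdist]; omega)
  have := h.le_dist (x' := (g₁, t₁)) (m' := (g₁, t)) (y' := (g₁, g₂))
    ⟨by simp only [hdist, SimpleGraph.dist_self]; omega, by rw [hw]; exact h'.symm.left_ne.symm,
      by rw [hcol]; exact hgy.symm, by rw [hw]; exact hgw.symm⟩
  simp only [hdist, SimpleGraph.dist_self] at this
  omega

lemma color_cases [Nontrivial V] [Nontrivial W] (hG : IsModular G) (hH : IsModular H)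
    (hc : RainbowFree (G □ H) c) (h : RainbowEnds (G □ H) c d w x y) (g : V × W) :
    c g = c x ∨ c g = c y ∨ c g = w := by
  by_contra! hg
  have hGH := hG.boxProd hH
  have := h.dist_lt_of_color_ne hG hH hc hg.2.1 hg.2.2
  have := h.symm.dist_lt_of_color_ne hG hH hc hg.1 hg.2.2
  obtain ⟨n, hxny, hyng, hxng⟩ := hGH.exists_median x y g
  have := h.dist_eq
  have := (G □ H).dist_comm (u := y) (v := n)
  have hn : c n = w := h.color_eq hGH hc (by omega) (by omega) (by omega)
  have := h.le_dist (x' := x) (m' := n) (y' := g)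
    ⟨hxng, by rw [hn]; exact h.left_ne, by rw [hn]; exact hg.2.2.symm, hg.1.symm⟩
  omega

/- Walking `x`, `u`, `z` in steps of length `d` gives `z` the color of `x`, but as a vertex between
the ends `x` and `v` it has the third color. -/
lemma false_of_between [Nontrivial V] [Nontrivial W] (hG : IsModular G) (hH : IsModular H)
    (hc : RainbowFree (G □ H) c) (h : RainbowEnds (G □ H) c d w x y) {u z v : V} {u' z' v' : W}
    (hu : G.dist x.1 u + H.dist x.2 u' = d) (huz : G.dist u z + H.dist u' z' = d)
    (hv : G.dist x.1 v + H.dist x.2 v' = d)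
    (hxzv : G.dist x.1 z + H.dist x.2 z' + (G.dist z v + H.dist z' v') = d)
    (hxz : G.dist x.1 z + H.dist x.2 z' ≠ 0) (hzv : G.dist z v + H.dist z' v' ≠ 0) : False := by
  have hdist := dist_boxProd hG.connected hH.connected
  obtain ⟨-, hcol⟩ := (h.sphere hG hH hc hu).1.symm.sphere hG hH hc huz
  have hw := (h.sphere hG hH hc hv).1.color_eq (hG.boxProd hH) hc (z := (z, z'))
    (by simpa only [hdist] using hxzv) (by simpa only [hdist] using hxz)
    (by simpa only [hdist] using hzv)
  exact h.left_ne (hcol.symm.trans hw)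

end RainbowEnds

end Product

section ThreeCase

variable {V W C : Type*} {G T : SimpleGraph V} {H T' : SimpleGraph W} {c : V × W → C} {d : ℕ}
  {w : C} {x y : V × W}

namespace RainbowEnds

lemma false_of_two_farthest [Nontrivial V] [Nontrivial W] (hG : IsModular G) (hH : IsModular H)
    (hc : RainbowFree (G □ H) c) (h : RainbowEnds (G □ H) c d w x y) {p q : V} (hpq : p ≠ q)
    (heq : G.dist x.1 p = G.dist x.1 q) (hfar : ∀ z, G.dist x.1 z ≤ G.dist x.1 p)
    (hle : G.dist x.1 p ≤ G.dist p q) : False := by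
  have hd := h.dist_add_dist_eq hG.connected hH.connected
  have := hG.connected.pos_dist_of_ne hpq
  have := h.dist_fst_lt hG hH hc p
  have := hfar y.1
  obtain ⟨t, ht, -⟩ := exists_dist_eq_of_le hH.connected (x := x.2) (y := y.2)
    (k := d - G.dist x.1 p) (by omega)
  have hpt := (h.sphere hG hH hc (a := p) (b := t) (by omega)).1.symm
  have : G.dist p q < d := hpt.dist_fst_lt hG hH hc q
  obtain ⟨t', ht', htt'⟩ := exists_dist_eq_of_le hH.connected (x := t) (y := x.2)
    (k := d - G.dist p q) (by rw [H.dist_comm]; omega)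
  have := H.dist_comm (u := t) (v := x.2)
  have := H.dist_comm (u := t') (v := x.2)
  have := H.dist_comm (u := t') (v := t)
  have hqq := G.dist_self (v := q)
  exact h.false_of_between hG hH hc (u := p) (u' := t) (z := q) (z' := t') (v := q) (v' := t)
    (by omega) (by omega) (by omega) (by omega) (by omega) (by omega)

/- Two of three vertices at distance `diam T` from each other are farthest from `x.1`. -/
lemma not_isPeripheral_three [Nontrivial V] [Nontrivial W] (hT : T.IsTree) (hb : T.ediam ≠ ⊤)
    (hH : IsModular H) (hc : RainbowFree (T □ H) c) (h : RainbowEnds (T □ H) c d w x y) :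
    ¬ IsPeripheral 3 T := by
  rw [isPeripheral_three_iff hT.1]
  rintro ⟨h0, p, q, r, hpq, hpr, hqr⟩
  have hne {a b : V} (hab : T.dist a b = T.diam) : a ≠ b := by
    rintro rfl
    exact h0 (hab.symm.trans SimpleGraph.dist_self)
  have hmax_pq := dist_le_max_of_diametral hT hb hpq x.1
  have hmax_pr := dist_le_max_of_diametral hT hb hpr x.1
  have hmax_qr := dist_le_max_of_diametral hT hb hqr x.1
  have := hmax_pq r
  have := hmax_pr q
  have := hmax_qr p
  have := dist_le_diam hb (u := x.1) (v := p)
  have := dist_le_diam hb (u := x.1) (v := q)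
  have hfar {a b : V} (hab : T.dist a b = T.diam) (heq : T.dist x.1 a = T.dist x.1 b) : False :=
    h.false_of_two_farthest (isModular_of_isTree hT) hH hc (hne hab) heq
      (fun z ↦ by
        have := dist_le_max_of_diametral hT hb hab x.1 z
        rwa [← heq, max_self] at this)
      (hab ▸ dist_le_diam hb)
  rcases (by omega : T.dist x.1 p = T.dist x.1 q ∨ T.dist x.1 p = T.dist x.1 r ∨
    T.dist x.1 q = T.dist x.1 r) with heq | heq | heq
  exacts [hfar hpq heq, hfar hpr heq, hfar hqr heq]

lemma diam_add_diam_le_of_diam_eq_one [Nontrivial V] [Nontrivial W] (hG : IsModular G)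
    (hbG : G.ediam ≠ ⊤) (hT' : T'.IsTree) (hb' : T'.ediam ≠ ⊤) (hc : RainbowFree (G □ T') c)
    (h : RainbowEnds (G □ T') c d w x y) (hdiam : G.diam = 1) : G.diam + T'.diam ≤ d := by
  have hH := isModular_of_isTree hT'
  have := hG.connected.pos_dist_of_ne (h.fst_ne hG hH hc)
  have := dist_le_diam hbG (u := x.1) (v := y.1)
  have := h.dist_add_dist_eq hG.connected hH.connected
  obtain ⟨z, hz⟩ := exists_dist_eq_diam_of_farthest hT' hb' (x := x.2) (y := y.2) fun z ↦ by
    have := h.dist_snd_lt hG hH hc z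
    omega
  have := h.symm.dist_snd_lt hG hH hc z
  omega

lemma exists_over_diametral [Nontrivial V] [Nontrivial W] (hT : T.IsTree) (hb : T.ediam ≠ ⊤)
    (hT' : T'.IsTree) (hb' : T'.ediam ≠ ⊤) (hc : RainbowFree (T □ T') c)
    (h : RainbowEnds (T □ T') c d w x y) (hd : d < T.diam + T'.diam) {p q : V}
    (hpq : T.dist p q = T.diam) : ∃ t t' y, d < T.diam + T'.dist t t' ∧
      (RainbowEnds (T □ T') c d w (p, t) y ∨ RainbowEnds (T □ T') c d w (q, t) y) := by
  have hG := isModular_of_isTree hT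
  have hH := isModular_of_isTree hT'
  wlog hfar : T.dist x.1 q ≤ T.dist x.1 p generalizing p q
  · obtain ⟨t, t', y, ht, hy⟩ := this (p := q) (q := p) (by rw [T.dist_comm, hpq]) (by omega)
    exact ⟨t, t', y, ht, hy.symm⟩
  have := dist_le_max_of_diametral hT hb hpq x.1 y.1
  have := h.dist_add_dist_eq hT.1 hT'.1
  have := h.dist_fst_lt hG hH hc p
  obtain ⟨t, ht, -⟩ := exists_dist_eq_of_le hT'.1 (x := x.2) (y := y.2)
    (k := d - T.dist x.1 p) (by omega)
  have hpt := (h.sphere hG hH hc (a := p) (b := t) (by omega)).1.symm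
  by_cases! hex : ∃ t', d < T.diam + T'.dist t t'
  · obtain ⟨t', ht'⟩ := hex
    exact ⟨t, t', x, ht', .inl hpt⟩
  · have := hex x.2
    have := T'.dist_comm (u := t) (v := x.2)
    have := dist_le_diam hb (u := x.1) (v := p)
    obtain ⟨z, hz⟩ := exists_dist_eq_diam_of_farthest hT' hb' (x := t) (y := x.2) fun z ↦ by
      have := hex z
      omega
    exact ⟨x.2, z, (p, t), by omega,
      .inr (hpt.sphere hG hH hc (a := q) (b := x.2) (by dsimp only; omega)).1.symm⟩

lemma false_of_short_legs [Nontrivial V] [Nontrivial W] (hG : IsModular G) (hH : IsModular H)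
    (hc : RainbowFree (G □ H) c) {p q u : V} {t t' : W}
    (h : RainbowEnds (G □ H) c d w (p, t) y) (hup : G.dist u p + 1 = G.dist p q)
    (huq : G.dist u q + 1 = G.dist p q) (ht : d < G.dist p q + H.dist t t') : False := by
  have : G.dist p q < d := h.dist_fst_lt hG hH hc q
  obtain ⟨t₁, ht₁, -⟩ := exists_dist_eq_of_le hH.connected (x := t) (y := t')
    (k := d - G.dist p q) (by omega)
  obtain ⟨t₂, ht₂, -⟩ := exists_dist_eq_of_le hH.connected (x := t) (y := t')
    (k := d - G.dist p q + 1) (by omega)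
  have := G.dist_comm (u := u) (v := p)
  have := H.dist_comm (u := t₂) (v := t)
  have := G.dist_self (v := q)
  have := H.dist_self (v := t)
  exact h.false_of_between hG hH hc (u := u) (u' := t₂) (z := q) (z' := t) (v := q) (v' := t₁)
    (by dsimp only; omega) (by omega) (by dsimp only; omega) (by dsimp only; omega)
    (by dsimp only; omega) (by omega)

lemma false_of_short_leg [Nontrivial V] [Nontrivial W] (hG : IsModular G) (hH : IsModular H)
    (hc : RainbowFree (G □ H) c) {p q u : V} {t t' : W}
    (h : RainbowEnds (G □ H) c d w (p, t) y) (hpu : G.dist p u + 1 = G.dist p q)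
    (hqu : G.dist q u = G.dist p q) (h2 : 2 ≤ G.dist p q)
    (ht : d < G.dist p q + H.dist t t') : False := by
  have : G.dist p q < d := h.dist_fst_lt hG hH hc q
  obtain ⟨t₁, ht₁, -⟩ := exists_dist_eq_of_le hH.connected (x := t) (y := t')
    (k := d - G.dist p q) (by omega)
  obtain ⟨t₂, ht₂, -⟩ := exists_dist_eq_of_le hH.connected (x := t) (y := t')
    (k := d - G.dist p q + 1) (by omega)
  have := H.dist_comm (u := t₁) (v := t)
  have := G.dist_self (v := u)
  have := H.dist_self (v := t)
  exact h.false_of_between hG hH hc (u := q) (u' := t₁) (z := u) (z' := t) (v := u) (v' := t₂)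
    (by dsimp only; omega) (by omega) (by dsimp only; omega) (by dsimp only; omega)
    (by dsimp only; omega) (by omega)

lemma diam_add_diam_le_of_isWeaklyNonThreePeripheral [Nontrivial V] [Nontrivial W]
    (hT : T.IsTree) (hb : T.ediam ≠ ⊤) (hT' : T'.IsTree) (hb' : T'.ediam ≠ ⊤)
    (hc : RainbowFree (T □ T') c) (h : RainbowEnds (T □ T') c d w x y)
    (hweak : IsWeaklyNonThreePeripheral T) : T.diam + T'.diam ≤ d := by
  by_contra! hd
  have hG := isModular_of_isTree hT
  have hH := isModular_of_isTree hT'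
  obtain ⟨hn, ⟨-, hodd⟩ | ⟨-, u, hu⟩⟩ := hweak
  · obtain ⟨p, q, hpq⟩ := T.exists_dist_eq_diam
    have hfalse {p q : V} {t t' : W} {y : V × W} (hpq : T.dist p q = T.diam)
        (ht : d < T.diam + T'.dist t t') (h : RainbowEnds (T □ T') c d w (p, t) y) : False := by
      obtain ⟨h2, u, hpu, hqu⟩ := (isPeripheral_removeFar_iff hT hb hpq).1
        (hodd p ((isPeripheralVertex_iff hT.1 hb).2 ⟨q, hpq⟩))
      exact h.false_of_short_leg hG hH hc (hpu.trans hpq.symm) (hqu.trans hpq.symm)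
        (h2.trans_eq hpq.symm) (hpq ▸ ht)
    obtain ⟨t, t', y, ht, hp | hq⟩ := h.exists_over_diametral hT hb hT' hb' hc hd hpq
    exacts [hfalse hpq ht hp, hfalse (T.dist_comm.trans hpq) ht hq]
  · obtain ⟨p, q, hpq, hup, huq⟩ := (isPeripheral_addLeaf_iff hT hb hn).1 hu
    rw [← hpq] at hup huq
    obtain ⟨t, t', y, ht, hp | hq⟩ := h.exists_over_diametral hT hb hT' hb' hc hd hpq
    · exact hp.false_of_short_legs hG hH hc hup huq (hpq ▸ ht)
    · rw [← hpq] at ht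
      rw [T.dist_comm (u := p)] at hup huq ht
      exact hq.false_of_short_legs hG hH hc huq hup ht

lemma false_of_left [Nontrivial V] [Nontrivial W] (hT : T.IsTree) (hb : T.ediam ≠ ⊤)
    (hT' : T'.IsTree) (hb' : T'.ediam ≠ ⊤) (hc : RainbowFree (T □ T') c)
    (h : RainbowEnds (T □ T') c d w x y)
    (hcase : IsPeripheral 3 T ∨ Even (T.diam + T'.diam) ∧
      (Nonempty (T ≃g pathGraph 2) ∨ IsWeaklyNonThreePeripheral T)) : False := by
  have hG := isModular_of_isTree hT
  have hH := isModular_of_isTree hT'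
  rcases hcase with hper | ⟨heven, hcase⟩
  · exact h.not_isPeripheral_three hT hb hH hc hper
  have hle : T.diam + T'.diam ≤ d := by
    rcases hcase with hiso | hweak
    · exact h.diam_add_diam_le_of_diam_eq_one hG hb hT' hb' hc
        ((nonempty_iso_pathGraph_two_iff hT).1 hiso)
    · exact h.diam_add_diam_le_of_isWeaklyNonThreePeripheral hT hb hT' hb' hc hweak
  have hge : d ≤ T.diam + T'.diam := by
    rw [← h.dist_add_dist_eq hT.1 hT'.1]
    exact Nat.add_le_add (dist_le_diam hb) (dist_le_diam hb')
  have hodd := h.odd (hG.boxProd hH).connected hc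
  exact Nat.not_odd_iff_even.2 heven (le_antisymm hge hle ▸ hodd)

lemma not_threeCase [Nontrivial V] [Nontrivial W] (hT : T.IsTree) (hb : T.ediam ≠ ⊤)
    (hT' : T'.IsTree) (hb' : T'.ediam ≠ ⊤) (hc : RainbowFree (T □ T') c)
    (h : RainbowEnds (T □ T') c d w x y) : ¬ ThreeCase T T' := by
  rw [ThreeCase, diam_boxProd hT.1 hT'.1 hb hb']
  have hleft := h.false_of_left hT hb hT' hb' hc
  have hright := (h.swap hT.1 hT'.1).false_of_left hT' hb' hT hb (hc.swap hT.1 hT'.1)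
  rw [add_comm T'.diam] at hright
  tauto

end RainbowEnds

end ThreeCase

section Converse

variable {V W : Type*} {G T : SimpleGraph V} {T' : SimpleGraph W} {p q s t : V} {p' q' : W}

/- By parity, no 3-AP has an end in `R` and an end in `B`, and if its middle vertex is in `R`, then
both or none of its ends are in `B`. -/
lemma exists_rainbowFree_of_spheres (hG : IsModular G) {R B : Set V} {e : ℕ} (he : Odd e)
    (hR : ∀ r ∈ R, ∀ z, G.dist r z = e ↔ z ∈ B) (hB : ∀ b ∈ B, ∀ z, G.dist b z = e ↔ z ∈ R)
    {r b g : V} (hr : r ∈ R) (hb : b ∈ B) (hgR : g ∉ R) (hgB : g ∉ B) :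
    ∃ c : V → Fin 3, Function.Surjective c ∧ RainbowFree G c := by
  classical
  have hdisj (x : V) (hxR : x ∈ R) : x ∉ B := by
    rw [← hR x hxR, SimpleGraph.dist_self]
    rintro rfl
    exact absurd he (by decide)
  have hends (x y z : V) (h : G.dist x y = G.dist y z) (hx : x ∈ R) : z ∉ B := by
    rw [← hR x hx]
    rintro rfl
    have := hG.even_perimeter x y z
    rw [h, Nat.even_add, Nat.even_add] at this
    exact Nat.not_even_iff_odd.2 he (this.1 Iff.rfl)
  refine ⟨fun x ↦ if x ∈ R then 0 else if x ∈ B then 1 else 2, fun i ↦ ?_,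
    fun x y z h hxy hyz ↦ ?_⟩
  · fin_cases i
    · exact ⟨r, by simp [hr]⟩
    · have hbR : b ∉ R := fun hbR ↦ hdisj b hbR hb
      exact ⟨b, by simp [hb, hbR]⟩
    · exact ⟨g, by simp [hgR, hgB]⟩
  · have hxz := hends x y z h
    have hzx := hends z y x (by rw [G.dist_comm, ← h, G.dist_comm])
    have hyR (hy : y ∈ R) : x ∈ B ↔ z ∈ B := by rw [← hR y hy, ← hR y hy, ← h, G.dist_comm]
    have hyB (hy : y ∈ B) : x ∈ R ↔ z ∈ R := by rw [← hB y hy, ← hB y hy, ← h, G.dist_comm]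
    have := hdisj x
    have := hdisj y
    have := hdisj z
    dsimp only at hxy hyz ⊢
    grind

lemma diam_eq_zero_of_not_isPeripheral_three (hT : T.IsTree) (hn : ¬ IsPeripheral 3 T) {r : V}
    (hpq : T.dist p q = T.diam) (hrp : T.dist r p = T.diam) (hrq : T.dist r q = T.diam) :
    T.diam = 0 := by
  rw [isPeripheral_three_iff hT.1] at hn
  by_contra h0
  exact hn ⟨h0, r, p, q, hrp, hrq, hpq⟩

lemma dist_eq_diam_iff (hT : T.IsTree) (hb : T.ediam ≠ ⊤) (hn : ¬ IsPeripheral 3 T)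
    (hpq : T.dist p q = T.diam) (hsq : T.dist s q = T.diam) (z : V) :
    T.dist s z = T.diam ↔ T.dist z p = T.diam := by
  have := dist_le_diam hb (u := s) (v := p)
  have := dist_le_diam hb (u := z) (v := p)
  have := dist_le_diam hb (u := z) (v := q)
  have := dist_le_diam hb (u := s) (v := z)
  have hnot {r : V} := diam_eq_zero_of_not_isPeripheral_three hT hn (r := r) hpq
  constructor
  · intro hz
    have := four_point hT s z p q
    have := hnot (r := s)
    omega
  · intro hz
    have := four_point hT s q z p
    have := T.dist_comm (u := z) (v := q)
    have := T.dist_comm (u := z) (v := p)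
    have := T.dist_comm (u := q) (v := p)
    have := hnot (r := z) hz
    omega

lemma exists_rainbowFree_of_odd [Nontrivial V] [Nontrivial W] (hT : T.IsTree) (hb : T.ediam ≠ ⊤)
    (hT' : T'.IsTree) (hb' : T'.ediam ≠ ⊤) (hn : ¬ IsPeripheral 3 T) (hn' : ¬ IsPeripheral 3 T')
    (hodd : Odd (T.diam + T'.diam)) :
    ∃ c : V × W → Fin 3, Function.Surjective c ∧ RainbowFree (T □ T') c := by
  obtain ⟨p, q, hpq⟩ := T.exists_dist_eq_diam
  obtain ⟨p', q', hpq'⟩ := T'.exists_dist_eq_diam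
  have hqp := T.dist_comm.trans hpq
  have hqp' := T'.dist_comm.trans hpq'
  have h0 := diam_ne_zero_of_ediam_ne_top hb
  have h0' := diam_ne_zero_of_ediam_ne_top hb'
  have hle {x y : V} : T.dist x y ≤ T.diam := dist_le_diam hb
  have hle' {x y : W} : T'.dist x y ≤ T'.diam := dist_le_diam hb'
  refine exists_rainbowFree_of_spheres ((isModular_of_isTree hT).boxProd (isModular_of_isTree hT'))
    hodd (R := {x | T.dist x.1 q = T.diam ∧ T'.dist x.2 q' = T'.diam})
    (B := {x | T.dist x.1 p = T.diam ∧ T'.dist x.2 p' = T'.diam})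
    (r := (p, p')) (b := (q, q')) (g := (p, q')) ?_ ?_ ⟨hpq, hpq'⟩ ⟨hqp, hqp'⟩
    (fun hg ↦ h0' (hg.2.symm.trans SimpleGraph.dist_self))
    (fun hg ↦ h0 (hg.1.symm.trans SimpleGraph.dist_self))
  · rintro r ⟨hr, hr'⟩ z
    rw [dist_boxProd hT.1 hT'.1, Set.mem_ofPred_eq, ← dist_eq_diam_iff hT hb hn hpq hr,
      ← dist_eq_diam_iff hT' hb' hn' hpq' hr', add_eq_add_iff_eq_and_eq hle hle']
  · rintro b ⟨hb₁, hb₂⟩ z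
    rw [dist_boxProd hT.1 hT'.1, Set.mem_ofPred_eq, ← dist_eq_diam_iff hT hb hn hqp hb₁,
      ← dist_eq_diam_iff hT' hb' hn' hqp' hb₂, add_eq_add_iff_eq_and_eq hle hle']

/-- Diametral pairs `p`, `q` such that the vertices at distance `diam T - 1` from `p` are at
distance less than `diam T - 1` from `q`. They exist in those trees that are neither 3-peripheral
nor weakly non-3-peripheral nor single edges. -/
structure IsStronglyDiametral (T : SimpleGraph V) (p q : V) : Prop where
  dist_eq : T.dist p q = T.diam
  dist_add_one_lt : ∀ t, T.dist t p + 1 = T.diam → T.dist t q + 1 < T.diam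

namespace IsStronglyDiametral

lemma dist_lt (hT : T.IsTree) (hb : T.ediam ≠ ⊤) (h : IsStronglyDiametral T p q)
    (ht : T.dist t p + 1 = T.diam) (z : V) : T.dist t z < T.diam := by
  have := dist_le_max_of_diametral hT hb h.dist_eq t z
  have := h.dist_add_one_lt t ht
  omega

lemma dist_add_one_eq_diam_iff (hT : T.IsTree) (hb : T.ediam ≠ ⊤) (hn : ¬ IsPeripheral 3 T)
    (h : IsStronglyDiametral T p q) (hsq : T.dist s q = T.diam) (z : V) :
    T.dist s z + 1 = T.diam ↔ T.dist z p + 1 = T.diam := by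
  have := h.dist_eq
  have := dist_le_diam hb (u := s) (v := p)
  have := diam_eq_zero_of_not_isPeripheral_three hT hn h.dist_eq (r := s)
  constructor
  · intro hz
    have := dist_le_diam hb (u := z) (v := p)
    have := dist_le_diam hb (u := z) (v := q)
    have := four_point hT s z p q
    have := (dist_eq_diam_iff hT hb hn h.dist_eq hsq z).2
    have := h.dist_add_one_lt s
    omega
  · intro hz
    have := h.dist_lt hT hb hz s
    have := h.dist_lt hT hb hz q
    have := four_point hT z p s q
    have := T.dist_comm (u := z) (v := s)
    have := T.dist_comm (u := p) (v := s)
    omega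

lemma dist_eq_diam_iff (hT : T.IsTree) (hb : T.ediam ≠ ⊤) (hn : ¬ IsPeripheral 3 T)
    (h : IsStronglyDiametral T p q) (ht : T.dist t p + 1 = T.diam) (z : V) :
    T.dist t z + 1 = T.diam ↔ T.dist z q = T.diam := by
  constructor
  · intro hz
    have := h.dist_eq
    have := h.dist_add_one_lt t ht
    have := dist_le_diam hb (u := z) (v := p)
    have := dist_le_diam hb (u := z) (v := q)
    have := four_point hT t z p q
    omega
  · intro hz
    rw [T.dist_comm, h.dist_add_one_eq_diam_iff hT hb hn hz, ht]

end IsStronglyDiametral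

lemma exists_isStronglyDiametral [Nontrivial V] (hT : T.IsTree) (hb : T.ediam ≠ ⊤)
    (h1 : T.diam ≠ 1) (hn : ¬ IsPeripheral 3 T) (hweak : ¬ IsWeaklyNonThreePeripheral T) :
    ∃ p q, IsStronglyDiametral T p q := by
  have hparity {p q : V} (hpq : T.dist p q = T.diam) (t : V) (ht : T.dist t p + 1 = T.diam) :
      T.dist t q % 2 = 1 := by
    have := even_perimeter hT t p q
    rw [Nat.even_iff] at this
    omega
  rcases Nat.even_or_odd T.diam with heven | hodd
  · obtain ⟨p, q, hpq⟩ := T.exists_dist_eq_diam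
    refine ⟨p, q, hpq, fun t ht ↦ ?_⟩
    have hne : T.dist t q + 1 ≠ T.diam := fun hq ↦ hweak
      ⟨hn, .inr ⟨heven, t, (isPeripheral_addLeaf_iff hT hb hn).2 ⟨p, q, hpq, ht, hq⟩⟩⟩
    have := dist_le_diam hb (u := t) (v := q)
    have := hparity hpq t ht
    rw [Nat.even_iff] at heven
    omega
  · obtain ⟨p, hp, hfar⟩ : ∃ p, IsPeripheralVertex T p ∧ ¬ IsPeripheral 3 (removeFar T p) := by
      by_contra! hall
      exact hweak ⟨hn, .inl ⟨hodd, hall⟩⟩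
    obtain ⟨q, hpq⟩ := (isPeripheralVertex_iff hT.1 hb).1 hp
    rw [isPeripheral_removeFar_iff hT hb hpq] at hfar
    refine ⟨p, q, hpq, fun t ht ↦ ?_⟩
    have := diam_ne_zero_of_ediam_ne_top hb
    have hne : T.dist t q ≠ T.diam := fun hq ↦
      hfar ⟨by omega, t, by rwa [T.dist_comm], by rwa [T.dist_comm]⟩
    have := dist_le_diam hb (u := t) (v := q)
    have := hparity hpq t ht
    rw [Nat.odd_iff] at hodd
    omega

lemma IsStronglyDiametral.dist_boxProd_add_one_eq_iff (hT : T.IsTree) (hb : T.ediam ≠ ⊤)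
    (hT' : T'.IsTree) (hb' : T'.ediam ≠ ⊤) (hn : ¬ IsPeripheral 3 T) (hn' : ¬ IsPeripheral 3 T')
    (h : IsStronglyDiametral T p q) (h' : IsStronglyDiametral T' p' q') {r : V × W}
    (hr : T.dist r.1 q = T.diam) (hr' : T'.dist r.2 q' = T'.diam) (z : V × W) :
    (T □ T').dist r z + 1 = T.diam + T'.diam ↔
      (T.dist z.1 p = T.diam ∧ T'.dist z.2 p' + 1 = T'.diam) ∨
        (T.dist z.1 p + 1 = T.diam ∧ T'.dist z.2 p' = T'.diam) := by
  have := AntiVdW.dist_eq_diam_iff hT hb hn h.dist_eq hr z.1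
  have := AntiVdW.dist_eq_diam_iff hT' hb' hn' h'.dist_eq hr' z.2
  have := h.dist_add_one_eq_diam_iff hT hb hn hr z.1
  have := h'.dist_add_one_eq_diam_iff hT' hb' hn' hr' z.2
  have := dist_le_diam hb (u := r.1) (v := z.1)
  have := dist_le_diam hb' (u := r.2) (v := z.2)
  rw [dist_boxProd hT.1 hT'.1]
  omega

lemma IsStronglyDiametral.dist_boxProd_add_one_eq_iff_of_snd (hT : T.IsTree) (hb : T.ediam ≠ ⊤)
    (hT' : T'.IsTree) (hb' : T'.ediam ≠ ⊤) (hn : ¬ IsPeripheral 3 T) (hn' : ¬ IsPeripheral 3 T')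
    (hpq : T.dist p q = T.diam) (h' : IsStronglyDiametral T' p' q') {b : V × W}
    (hbp : T.dist b.1 p = T.diam) (hbp' : T'.dist b.2 p' + 1 = T'.diam) (z : V × W) :
    (T □ T').dist b z + 1 = T.diam + T'.diam ↔
      T.dist z.1 q = T.diam ∧ T'.dist z.2 q' = T'.diam := by
  have := AntiVdW.dist_eq_diam_iff hT hb hn (T.dist_comm.trans hpq) hbp z.1
  have := h'.dist_eq_diam_iff hT' hb' hn' hbp' z.2
  have := dist_le_diam hb (u := b.1) (v := z.1)
  have := h'.dist_lt hT' hb' hbp' z.2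
  rw [dist_boxProd hT.1 hT'.1]
  omega

lemma exists_rainbowFree_of_even [Nontrivial V] [Nontrivial W] (hT : T.IsTree) (hb : T.ediam ≠ ⊤)
    (hT' : T'.IsTree) (hb' : T'.ediam ≠ ⊤) (hn : ¬ IsPeripheral 3 T) (hn' : ¬ IsPeripheral 3 T')
    (heven : Even (T.diam + T'.diam)) (h : IsStronglyDiametral T p q)
    (h' : IsStronglyDiametral T' p' q') :
    ∃ c : V × W → Fin 3, Function.Surjective c ∧ RainbowFree (T □ T') c := by
  have h0 := diam_ne_zero_of_ediam_ne_top hb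
  have h0' := diam_ne_zero_of_ediam_ne_top hb'
  obtain ⟨e, he⟩ : ∃ e, e + 1 = T.diam + T'.diam := ⟨T.diam + T'.diam - 1, by omega⟩
  have hodd : Odd e := Nat.not_even_iff_odd.1 (Nat.even_add_one.1 (he ▸ heven))
  have hdist (x z : V × W) :
      (T □ T').dist x z = e ↔ (T □ T').dist x z + 1 = T.diam + T'.diam := by omega
  obtain ⟨t, ht⟩ : ∃ t, T'.dist t p' + 1 = T'.diam := by
    have hle : T'.diam - 1 ≤ T'.dist p' q' := h'.dist_eq ▸ Nat.sub_le _ 1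
    obtain ⟨t, ht, -⟩ := exists_dist_eq_of_le hT'.1 hle
    exact ⟨t, by rw [T'.dist_comm]; omega⟩
  refine exists_rainbowFree_of_spheres ((isModular_of_isTree hT).boxProd (isModular_of_isTree hT'))
    hodd (R := {x | T.dist x.1 q = T.diam ∧ T'.dist x.2 q' = T'.diam})
    (B := {x | (T.dist x.1 p = T.diam ∧ T'.dist x.2 p' + 1 = T'.diam) ∨
      (T.dist x.1 p + 1 = T.diam ∧ T'.dist x.2 p' = T'.diam)})
    (r := (p, p')) (b := (q, t)) (g := (p, q')) (fun r hr z ↦ ?_) ?_ ⟨h.dist_eq, h'.dist_eq⟩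
    (.inl ⟨T.dist_comm.trans h.dist_eq, ht⟩)
    (fun hg ↦ h0' (hg.2.symm.trans SimpleGraph.dist_self)) ?_
  · rw [hdist]
    exact h.dist_boxProd_add_one_eq_iff hT hb hT' hb' hn hn' h' hr.1 hr.2 z
  · rintro b (⟨hbp, hbp'⟩ | ⟨hbp, hbp'⟩) z <;> rw [hdist]
    · exact h'.dist_boxProd_add_one_eq_iff_of_snd hT hb hT' hb' hn hn' h.dist_eq hbp hbp' z
    · rw [← dist_boxProd_swap hT.1 hT'.1, add_comm T.diam, h.dist_boxProd_add_one_eq_iff_of_snd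
        hT' hb' hT hb hn' hn h'.dist_eq (b := b.swap) hbp' hbp z.swap]
      exact and_comm
  · rintro (⟨hg, -⟩ | ⟨hg, -⟩)
    · exact h0 (hg.symm.trans SimpleGraph.dist_self)
    · exact (h.dist_lt hT hb hg q).ne h.dist_eq

lemma exists_rainbowFree_of_not_threeCase [Nontrivial V] [Nontrivial W] (hT : T.IsTree)
    (hb : T.ediam ≠ ⊤) (hT' : T'.IsTree) (hb' : T'.ediam ≠ ⊤) (hcase : ¬ ThreeCase T T') :
    ∃ c : V × W → Fin 3, Function.Surjective c ∧ RainbowFree (T □ T') c := by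
  rw [ThreeCase, diam_boxProd hT.1 hT'.1 hb hb', nonempty_iso_pathGraph_two_iff hT,
    nonempty_iso_pathGraph_two_iff hT'] at hcase
  rcases Nat.even_or_odd (T.diam + T'.diam) with heven | hodd
  · obtain ⟨p, q, h⟩ := exists_isStronglyDiametral hT hb (by tauto) (by tauto) (by tauto)
    obtain ⟨p', q', h'⟩ := exists_isStronglyDiametral hT' hb' (by tauto) (by tauto) (by tauto)
    exact exists_rainbowFree_of_even hT hb hT' hb' (by tauto) (by tauto) heven h h'
  · exact exists_rainbowFree_of_odd hT hb hT' hb' (by tauto) (by tauto) hodd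

end Converse

section AntiVanDerWaerden

variable {V W : Type*} {G : SimpleGraph V} {H : SimpleGraph W} {n : ℕ}

lemma hasRainbowAP_three_iff (hG : G.Connected) (c : V → Fin n) :
    HasRainbowAP G 3 c ↔ ¬ RainbowFree G c := by
  constructor
  · rintro ⟨v, ⟨d, hd⟩, hinj⟩ hc
    have h₀₁ := congrArg ENat.toNat (hd 0 (by decide))
    have h₁₂ := congrArg ENat.toNat (hd 1 (by decide))
    exact hinj.ne (a₁ := 0) (a₂ := 2) (by decide) (hc (v 0) (v 1) (v 2) (h₀₁.trans h₁₂.symm)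
      (hinj.ne (a₁ := 0) (a₂ := 1) (by decide)) (hinj.ne (a₁ := 1) (a₂ := 2) (by decide)))
  · intro h
    simp only [RainbowFree, not_forall] at h
    obtain ⟨x, y, z, hd, hxy, hyz, hxz⟩ := h
    refine ⟨![x, y, z], ⟨G.dist x y, fun i hi ↦ ?_⟩, fun i j hij ↦ ?_⟩
    · obtain rfl | rfl : i = 0 ∨ i = 1 := by omega
      · exact (hG x y).coe_dist_eq_edist.symm
      · rw [hd]
        exact (hG y z).coe_dist_eq_edist.symm
    · fin_cases i <;> fin_cases j <;> simp_all [eq_comm]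

lemma three_le_of_hasRainbowAP_three {c : V → Fin n} (h : HasRainbowAP G 3 c) : 3 ≤ n := by
  obtain ⟨v, -, hinj⟩ := h
  simpa using Fintype.card_le_of_injective _ hinj

lemma three_le_of_forall_hasRainbowAP_three [Nontrivial V] (h0 : 0 < n)
    (h : ∀ c : V → Fin n, Function.Surjective c → HasRainbowAP G 3 c) : 3 ≤ n := by
  classical
  by_contra! hn
  suffices ∃ c : V → Fin n, Function.Surjective c by
    obtain ⟨c, hc⟩ := this
    exact hn.not_ge (three_le_of_hasRainbowAP_three (h c hc))
  obtain ⟨x, y, hxy⟩ := exists_pair_ne V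
  obtain rfl | rfl : n = 1 ∨ n = 2 := by omega
  · exact ⟨fun _ ↦ 0, fun i ↦ ⟨x, Subsingleton.elim _ _⟩⟩
  · refine ⟨fun z ↦ if z = x then 0 else 1, fun i ↦ ?_⟩
    fin_cases i
    exacts [⟨x, by simp⟩, ⟨y, by simp [hxy.symm]⟩]

lemma aw_eq_three [Nontrivial V]
    (h : ∀ c : V → Fin 3, Function.Surjective c → HasRainbowAP G 3 c) : aw G 3 = 3 :=
  le_antisymm (Nat.sInf_le ⟨by decide, h⟩)
    (le_csInf ⟨3, by decide, h⟩ fun _ hr ↦ three_le_of_forall_hasRainbowAP_three hr.1 hr.2)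

lemma aw_eq_four [Nontrivial V]
    (h : ∀ c : V → Fin 4, Function.Surjective c → HasRainbowAP G 3 c) {c : V → Fin 3}
    (hc : Function.Surjective c) (hc' : ¬ HasRainbowAP G 3 c) : aw G 3 = 4 := by
  refine le_antisymm (Nat.sInf_le ⟨by decide, h⟩) (le_csInf ⟨4, by decide, h⟩ fun r hr ↦ ?_)
  rcases (three_le_of_forall_hasRainbowAP_three hr.1 hr.2).eq_or_lt with rfl | h4
  exacts [absurd (hr.2 c hc) hc', h4]

lemma exists_rainbowEnds (hG : IsModular G) (hn : 3 ≤ n) {c : V → Fin n}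
    (hs : Function.Surjective c) : ∃ d w x y, RainbowEnds G c d w x y := by
  obtain ⟨x, hx⟩ := hs ⟨0, by omega⟩
  obtain ⟨y, hy⟩ := hs ⟨1, by omega⟩
  obtain ⟨z, hz⟩ := hs ⟨2, by omega⟩
  obtain ⟨x', m', y', h⟩ := exists_shortestRainbow hG (c := c) (x := x) (y := y) (z := z)
    (by simp [hx, hy]) (by simp [hy, hz]) (by simp [hx, hz])
  exact ⟨_, _, x', y', m', h, rfl, rfl⟩

lemma not_rainbowFree_of_surjective [Nontrivial V] [Nontrivial W] (hG : IsModular G)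
    (hH : IsModular H) (hn : 4 ≤ n) {c : V × W → Fin n} (hs : Function.Surjective c) :
    ¬ RainbowFree (G □ H) c := by
  intro hc
  obtain ⟨d, w, x, y, h⟩ := exists_rainbowEnds (hG.boxProd hH) (by omega) hs
  have hcol : (Finset.univ : Finset (Fin n)) ⊆ {c x, c y, w} := fun i _ ↦ by
    obtain ⟨g, rfl⟩ := hs i
    simpa using h.color_cases hG hH hc g
  have := (Finset.card_le_card hcol).trans Finset.card_le_three
  rw [Finset.card_fin] at this
  omega

end AntiVanDerWaerden

end AntiVdW

theorem corollary1p4_general {V W : Type*} [Nontrivial V] [Nontrivial W]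
    (T : SimpleGraph V) (T' : SimpleGraph W) (hT : T.IsTree) (hT' : T'.IsTree)
    (hb : T.ediam ≠ ⊤) (hb' : T'.ediam ≠ ⊤) :
    (AntiVdW.ThreeCase T T' → AntiVdW.aw (T.boxProd T') 3 = 3) ∧
      (¬ AntiVdW.ThreeCase T T' → AntiVdW.aw (T.boxProd T') 3 = 4) := by
  have hG := AntiVdW.isModular_of_isTree hT
  have hH := AntiVdW.isModular_of_isTree hT'
  have hiff {n : ℕ} (c : V × W → Fin n) :=
    AntiVdW.hasRainbowAP_three_iff (hT.1.boxProd hT'.1) c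
  refine ⟨fun hcase ↦ AntiVdW.aw_eq_three fun c hs ↦ ?_, fun hcase ↦ ?_⟩
  · rw [hiff]
    intro hc
    obtain ⟨d, w, x, y, h⟩ := AntiVdW.exists_rainbowEnds (hG.boxProd hH) le_rfl hs
    exact h.not_threeCase hT hb hT' hb' hc hcase
  · obtain ⟨c, hs, hc⟩ := AntiVdW.exists_rainbowFree_of_not_threeCase hT hb hT' hb' hcase
    refine AntiVdW.aw_eq_four (fun c hs ↦ ?_) hs ((hiff c).not_left.2 hc)
    exact (hiff c).2 (AntiVdW.not_rainbowFree_of_surjective hG hH le_rfl hs)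

theorem corollary1p4 {V W : Type*} [Finite V] [Finite W] [Nontrivial V] [Nontrivial W]
    (T : SimpleGraph V) (T' : SimpleGraph W) (hT : T.IsTree) (hT' : T'.IsTree) :
    (AntiVdW.ThreeCase T T' → AntiVdW.aw (T.boxProd T') 3 = 3) ∧
      (¬ AntiVdW.ThreeCase T T' → AntiVdW.aw (T.boxProd T') 3 = 4) :=
  corollary1p4_general T T' hT hT' (SimpleGraph.connected_iff_ediam_ne_top.1 hT.1)
    (SimpleGraph.connected_iff_ediam_ne_top.1 hT'.1)
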